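/- A structured bounded-rate multi-mode system with two clocks and one variable consists of finitely many locations (modes), a set $\mathcal T$ of target locations, an initial location $\ell_0$, an initial rational value $z_0$ of the real variable $z$, for every location $\ell$ a nonempty bounded set $\mathcal R(\ell)\subseteq\mathbb R$ of rates of $z$ (a finite set of rationals, or a closed or open bounded interval with rational endpoints), and finitely many transitions between locations. Each transition carries a guard, i.e. a finite conjunction of constraints $x\sim c$ or $y\sim c$ with $c\in\mathbb N$ and $\sim\ \in\{<,\le,=,\ge,>\}$ on the two clocks $x,y$, and a set of clocks that it resets to $0$. Both clocks have rate $1$ in every location. The system is played by a scheduler and an environment, starting in $\ell_0$ with $x=y=0$, $z=z_0$. In each round the scheduler chooses a transition that leaves the current location and whose guard holds, and a time $t\ge 0$; the transition is taken, with its resets; then the environment chooses a rate $r\in\mathcal R(\ell)$, where $\ell$ is the location just entered, and $t$ time units elapse in $\ell$, so that $x,y$ grow by $t$ and $z$ changes linearly to $z+tr$. Strategies may depend on the whole finite history. Given a safety set $S\subseteq\mathbb R$, a target value $p$ and $\varepsilon>0$, the value $p$ is $\varepsilon$-reachable if the scheduler has a strategy such that, against every strategy of the environment, after finitely many rounds,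 during which $z$ always stays in $S$, the play visits a location of $\mathcal T$ with $|z-p|<\varepsilon$. It is robustly reachable if it is $\varepsilon$-reachable for every $\varepsilon>0$. **Theorem.** Reachability is undecidable for structured bounded-rate multi-mode systems with two clocks and one variable, already for the target value $p=7$. More precisely: 1. There is $L>7$ such that for every convex safety set $S\supseteq[-L,L]$ (for instance $S=\mathbb R$, i.e. no safety constraint) there is no algorithm that decides, given such a system with $z_0$ in the interior of $S$, whether $7$ is robustly reachable. 2. For every rational $\Delta$ with $0<\Delta<1$ there is $L>7$ such that for every convex safety set $S\supseteq[-L,L]$ there is no algorithm that decides, given such a system with $z_0$ in the interior of $S$, whether $7$ is $\Delta$-reachable. -/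

import Mathlib

/-! Structured bounded-rate multi-mode systems with two clocks and one bounded-rate variable:
finite syntax (so that a decision problem about them makes sense), the game between scheduler and
environment, and reachability of a ball around a target value. -/

/-- A rational number written as a fraction `num / (den + 1)`. -/
abbrev RatCode : Type := ℤ × ℕ

/-- The real number denoted by a fraction. -/
noncomputable def RatCode.value (q : RatCode) : ℝ := (q.1 : ℝ) / ((q.2 : ℝ) + 1)

/-- Description of the bounded set of rates of the variable in a location: a finite set, a closed
interval, or an open interval, with rational data. -/
inductive RateSet : Type where
  | finite (qs : List RatCode)
  | closedInterval (a b : RatCode)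
  | openInterval (a b : RatCode)

/-- The set of rates that is described. -/
def RateSet.toSet : RateSet → Set ℝ
  | .finite qs => {r | ∃ q ∈ qs, q.value = r}
  | .closedInterval a b => Set.Icc a.value b.value
  | .openInterval a b => Set.Ioo a.value b.value

def RateSet.equiv : RateSet ≃ List RatCode ⊕ (RatCode × RatCode) ⊕ (RatCode × RatCode) where
  toFun
    | .finite qs => Sum.inl qs
    | .closedInterval a b => Sum.inr (Sum.inl (a, b))
    | .openInterval a b => Sum.inr (Sum.inr (a, b))
  invFun
    | Sum.inl qs => .finite qs
    | Sum.inr (Sum.inl (a, b)) => .closedInterval a b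
    | Sum.inr (Sum.inr (a, b)) => .openInterval a b
  left_inv := by rintro (_ | _ | _) <;> rfl
  right_inv := by rintro (_ | ⟨_, _⟩ | ⟨_, _⟩) <;> rfl

instance RateSet.instPrimcodable : Primcodable RateSet := Primcodable.ofEquiv _ RateSet.equiv

/-- The comparison symbols of clock guards. -/
inductive Cmp : Type where
  | lt | le | eq | ge | gt

def Cmp.holds : Cmp → ℝ → ℝ → Prop
  | .lt, a, b => a < b
  | .le, a, b => a ≤ b
  | .eq, a, b => a = b
  | .ge, a, b => b ≤ a
  | .gt, a, b => b < a

def Cmp.equiv : Cmp ≃ Fin 5 where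
  toFun
    | .lt => 0
    | .le => 1
    | .eq => 2
    | .ge => 3
    | .gt => 4
  invFun
    | 0 => .lt
    | 1 => .le
    | 2 => .eq
    | 3 => .ge
    | 4 => .gt
  left_inv := by rintro (_ | _ | _ | _ | _) <;> rfl
  right_inv := by intro i; fin_cases i <;> rfl

instance Cmp.instPrimcodable : Primcodable Cmp := Primcodable.ofEquiv _ Cmp.equiv

/-- An atomic clock constraint `clock ∼ bound`, with a natural number as bound. -/
structure ClockConstraint : Type where
  clock : Fin 2
  cmp : Cmp
  bound : ℕ

def ClockConstraint.Sat (g : ClockConstraint) (ν : Fin 2 → ℝ) : Prop :=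
  g.cmp.holds (ν g.clock) g.bound

def ClockConstraint.equiv : ClockConstraint ≃ Fin 2 × Cmp × ℕ where
  toFun g := (g.clock, g.cmp, g.bound)
  invFun g := ⟨g.1, g.2.1, g.2.2⟩
  left_inv _ := rfl
  right_inv _ := rfl

instance ClockConstraint.instPrimcodable : Primcodable ClockConstraint :=
  Primcodable.ofEquiv _ ClockConstraint.equiv

/-- A transition between locations: its guard is the conjunction of a list of atomic clock
constraints, and it sets the clocks in `reset` to zero. -/
structure Edge : Type where
  src : ℕ
  guard : List ClockConstraint
  reset : List (Fin 2)
  dst : ℕ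

def Edge.equiv : Edge ≃ ℕ × List ClockConstraint × List (Fin 2) × ℕ where
  toFun e := (e.src, e.guard, e.reset, e.dst)
  invFun e := ⟨e.1, e.2.1, e.2.2.1, e.2.2.2⟩
  left_inv _ := rfl
  right_inv _ := rfl

instance Edge.instPrimcodable : Primcodable Edge := Primcodable.ofEquiv _ Edge.equiv

/-- A structured system with two clocks and one variable, together with its initial location, its
initial value of the variable and its target locations. The locations (modes) are the natural
numbers below the length of `rates`. -/
structure StructuredBMS : Type where
  rates : List RateSet
  edges : List Edge
  initLoc : ℕ
  initVal : RatCode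
  targets : List ℕ

def StructuredBMS.equiv :
    StructuredBMS ≃ List RateSet × List Edge × ℕ × RatCode × List ℕ where
  toFun H := (H.rates, H.edges, H.initLoc, H.initVal, H.targets)
  invFun H := ⟨H.1, H.2.1, H.2.2.1, H.2.2.2.1, H.2.2.2.2⟩
  left_inv _ := rfl
  right_inv _ := rfl

instance StructuredBMS.instPrimcodable : Primcodable StructuredBMS :=
  Primcodable.ofEquiv _ StructuredBMS.equiv

namespace StructuredBMS

/-- Every location mentioned exists, and every location has at least one rate. -/
def WellFormed (H : StructuredBMS) : Prop :=
  H.initLoc < H.rates.length ∧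
  (∀ e ∈ H.edges, e.src < H.rates.length ∧ e.dst < H.rates.length) ∧
  (∀ l ∈ H.targets, l < H.rates.length) ∧
  ∀ R ∈ H.rates, R.toSet.Nonempty

/-- The set of rates of the variable in location `l`. -/
def rateSet (H : StructuredBMS) (l : ℕ) : Set ℝ := {r | ∃ R, H.rates[l]? = some R ∧ r ∈ R.toSet}

/-- Current location, clock values, and value of the variable. -/
structure Config : Type where
  loc : ℕ
  clock : Fin 2 → ℝ
  val : ℝ

/-- A timed move of the scheduler: a transition to take now, and the time to spend afterwards in
the location that it enters. -/
structure Move : Type where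
  edge : Edge
  time : ℝ

/-- The timed move `m` is available to the scheduler in configuration `c`. -/
def Enabled (H : StructuredBMS) (c : Config) (m : Move) : Prop :=
  m.edge ∈ H.edges ∧ m.edge.src = c.loc ∧ (∀ g ∈ m.edge.guard, g.Sat c.clock) ∧ 0 ≤ m.time

/-- The configuration after the timed move `m` when the environment picks the rate `r`. Clocks
have rate one in every location. -/
def next (c : Config) (m : Move) (r : ℝ) : Config where
  loc := m.edge.dst
  clock := fun i => (if i ∈ m.edge.reset then 0 else c.clock i) + m.time
  val := c.val + m.time * r

/-- The initial configuration; both clocks are zero. -/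
noncomputable def start (H : StructuredBMS) : Config where
  loc := H.initLoc
  clock := fun _ => 0
  val := H.initVal.value

/-- A history of the game: the timed moves and the rates chosen so far, oldest first. With the
initial configuration it determines the finite run. -/
abbrev History : Type := List (Move × ℝ)

/-- The last configuration of the finite run with history `h`. -/
noncomputable def last (H : StructuredBMS) (h : History) : Config :=
  h.foldl (fun c s => next c s.1 s.2) H.start

/-- A strategy of the scheduler. -/
abbrev Scheduler : Type := History → Move

/-- A strategy of the environment. -/
abbrev Environment : Type := History → Move → ℝ

/-- The environment always picks a rate of the location that the timed move enters. -/
def Environment.Legal (H : StructuredBMS) (π : Environment) : Prop :=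
  ∀ h : History, ∀ m : Move, m.edge ∈ H.edges → π h m ∈ H.rateSet m.edge.dst

/-- The history after `n` rounds of the play in which the players follow `σ` and `π`. -/
def play (σ : Scheduler) (π : Environment) : ℕ → History
  | 0 => []
  | n + 1 => play σ π n ++ [(σ (play σ π n), π (play σ π n) (σ (play σ π n)))]

/-- Round `n` of the play is correct for the scheduler: the move is available, and the variable
stays in the safety set `S` while time elapses. -/
def RoundOK (H : StructuredBMS) (S : Set ℝ) (σ : Scheduler) (π : Environment) (n : ℕ) : Prop :=
  let h := play σ π n
  H.Enabled (H.last h) (σ h) ∧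
    ∀ s ∈ Set.Icc 0 (σ h).time, (H.last h).val + s * π h (σ h) ∈ S

/-- `p` is `ε`-reachable: some strategy of the scheduler guarantees against every legal strategy of
the environment that after finitely many available and safe moves a target location is visited with
the variable in the open ball of radius `ε` around `p`. -/
def Reachable (H : StructuredBMS) (S : Set ℝ) (p ε : ℝ) : Prop :=
  ∃ σ : Scheduler, ∀ π : Environment, π.Legal H →
    ∃ n, H.start.val ∈ S ∧ (∀ k < n, H.RoundOK S σ π k) ∧
      (H.last (play σ π n)).loc ∈ H.targets ∧ (H.last (play σ π n)).val ∈ Metric.ball p ε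

/-- `p` is robustly reachable: it is `ε`-reachable for every `ε > 0`. -/
def RobustlyReachable (H : StructuredBMS) (S : Set ℝ) (p : ℝ) : Prop :=
  ∀ ε : ℝ, 0 < ε → H.Reachable S p ε

/-- `H` is an instance of the reachability problem with safety set `S`: it is well-formed and
starts in the interior of `S`. -/
def IsInstance (H : StructuredBMS) (S : Set ℝ) : Prop :=
  H.WellFormed ∧ H.start.val ∈ interior S

end StructuredBMS

/-! The halting problem is reduced to non-reachability through two intermediate games.

Register machines. Halting of a partial recursive function becomes a win of the first player in an
alternating register machine (`exists_prog_of_partrec`). Alternation makes recursion cheap: the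
first player guesses intermediate values, the second picks one guess to be verified, and since only
that verification is carried out, register contents never have to be restored.

A game on one real number. The registers become the exponents of primes in the denominator of a
number `u`, and instructions multiply `u` by rationals. The second player, later the scheduler, does
the arithmetic; the first player, later the environment, objects to wrong results. To defend the
outcome of a zero test, the second player multiplies `u` by permitted primes until it is `1`.
Suppose errors below `η` go unpunished. If the first player wins the machine, the exact game has a
well-founded, finitely branching winning tree, so some `η > 0` does no harm
(`ExactWin.exists_robustWin`). Otherwise the second player plays honestly. Each instruction at least
halves `u`, and once `u < η` the claim `u = 0` passes (`secondWin_prog`). In this way an endless run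
turns into a finite win, for every `η > 0`.

The multi-mode system. One clock stores `1 + u`; the scheduler measures out `1 + u'` on the other,
and the environment answers through a rate that is a multiple of a large `J`. The scheduler has to
declare this answer, and a false declaration spoils `z` by at least `J`. An objection of sign `s`
ends the play with `z = b - s * (u' - correct value)`. For robust reachability `b = 7` and `η = ε`.
For a fixed radius `Δ` the environment first chooses `w` in the open interval `(0, Δ)` and `b = 7 -
Δ + w`, so errors of the objected sign must stay below `w`: the environment sets the tolerance and
cannot make it zero. The two directions are `EnvHyp.not_reachable` and `reachable_of_secondWin`. -/

namespace MultiModeGame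

/-! ### Alternating register machines

The first player tries to reach a `win` instruction, the second player tries to avoid it. -/

/-- Instructions of an alternating register machine with control states `Λ`. -/
inductive Instr (Λ : Type) : Type where
  | win
  | lose
  | incr (i : ℕ) (a : Λ)
  | decz (i : ℕ) (a b : Λ)
  | eor (a b : Λ)
  | sand (a b : Λ)

/-- The control states that can follow an instruction. -/
def Instr.succs {Λ : Type} : Instr Λ → List Λ
  | .win => []
  | .lose => []
  | .incr _ a => [a]
  | .decz _ a b => [a, b]
  | .eor a b => [a, b]
  | .sand a b => [a, b]

/-- `i` is the register used by the instruction. -/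
def Instr.Uses {Λ : Type} : Instr Λ → ℕ → Prop
  | .incr i _, j => i = j
  | .decz i _ _, j => i = j
  | _, _ => False

open Function (update)

/-- Positions from which the first player wins. At `eor` the first player chooses the successor, at
`sand` the second player does; `decz` branches on whether a register is zero and otherwise
decrements it. -/
inductive Wins {Λ : Type} (ins : Λ → Instr Λ) : Λ → (ℕ → ℕ) → Prop where
  | win {l r} : ins l = .win → Wins ins l r
  | incr {l r i a} : ins l = .incr i a → Wins ins a (update r i (r i + 1)) → Wins ins l r
  | deczZero {l r i a b} : ins l = .decz i a b → r i = 0 → Wins ins a r → Wins ins l r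
  | deczSucc {l r i a b} : ins l = .decz i a b → r i ≠ 0 →
      Wins ins b (update r i (r i - 1)) → Wins ins l r
  | eorLeft {l r a b} : ins l = .eor a b → Wins ins a r → Wins ins l r
  | eorRight {l r a b} : ins l = .eor a b → Wins ins b r → Wins ins l r
  | sand {l r a b} : ins l = .sand a b → Wins ins a r → Wins ins b r → Wins ins l r

section WinsIff

variable {Λ : Type} {ins : Λ → Instr Λ} {l a b : Λ} {r : ℕ → ℕ} {i : ℕ}

theorem not_wins_of_lose (h : ins l = .lose) : ¬ Wins ins l r := by
  intro H; cases H <;> simp_all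

theorem wins_incr_iff (h : ins l = .incr i a) :
    Wins ins l r ↔ Wins ins a (update r i (r i + 1)) := by
  constructor
  · intro H; cases H <;> simp_all
  · exact .incr h

theorem wins_decz_iff (h : ins l = .decz i a b) :
    Wins ins l r ↔ (r i = 0 → Wins ins a r) ∧ (r i ≠ 0 → Wins ins b (update r i (r i - 1))) := by
  constructor
  · intro H; cases H <;> simp_all
  · rintro ⟨h1, h2⟩
    by_cases h0 : r i = 0
    · exact .deczZero h h0 (h1 h0)
    · exact .deczSucc h h0 (h2 h0)

theorem wins_eor_iff (h : ins l = .eor a b) : Wins ins l r ↔ Wins ins a r ∨ Wins ins b r := by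
  constructor
  · intro H; cases H <;> simp_all
  · rintro (H | H)
    · exact .eorLeft h H
    · exact .eorRight h H

theorem wins_sand_iff (h : ins l = .sand a b) : Wins ins l r ↔ Wins ins a r ∧ Wins ins b r := by
  constructor
  · intro H; cases H <;> simp_all
  · rintro ⟨H1, H2⟩
    exact .sand h H1 H2

end WinsIff

/-! ### Structured programs and their winning conditions -/

/-- Structured programs for alternating register machines; each is a control state. -/
inductive Prog : Type where
  | win
  | lose
  | incr (i : ℕ) (a : Prog)
  | decz (i : ℕ) (a b : Prog)
  | eor (a b : Prog)
  | sand (a b : Prog)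
  | clear (i : ℕ) (a : Prog)
  | guess (i : ℕ) (a : Prog)
  | eq (i j : ℕ)
  | natRec (x o k : ℕ) (f f' g g' : Prog)
  | search (o k : ℕ) (g : Prog)

namespace Prog

/-- Overwrite the register `i` by a number that the first player chooses. -/
def choose (i : ℕ) (a : Prog) : Prog := .clear i (.guess i a)

/-- The instruction at a program. -/
def instr : Prog → Instr Prog
  | .win => .win
  | .lose => .lose
  | .incr i a => .incr i a
  | .decz i a b => .decz i a b
  | .eor a b => .eor a b
  | .sand a b => .sand a b
  | .clear i a => .decz i a (.clear i a)
  | .guess i a => .eor a (.incr i (.guess i a))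
  | .eq i j => .decz i (.decz j .win .lose) (.decz j .lose (.eq i j))
  -- To defend a value in `o`, guess the preceding value of the recursion in `k`; the second player
  -- then tests either the single step or the guess. Exchanging `o` and `k` in the second case
  -- avoids copying registers, which is why `f'` and `g'` are carried along as versions of `f` and
  -- `g` with output in `k`.
  | .natRec x o k f f' g g' => .decz x f (.choose k (.sand g (.natRec x k o f' f g' g)))
  -- The increment after the guess forces the value in `k` to be positive; `g` can then be used to
  -- test that it is the function value at the decremented `o`.
  | .search o k g => .decz o .win (.choose k (.incr k (.sand g (.search o k g))))

/-- The first player wins from the program `P` with registers `r`. -/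
abbrev Win (P : Prog) (r : ℕ → ℕ) : Prop := Wins instr P r

theorem win_clear {i : ℕ} {a : Prog} {r : ℕ → ℕ} :
    (Prog.clear i a).Win r ↔ a.Win (update r i 0) := by
  generalize hk : r i = k
  induction k generalizing r with
  | zero =>
    rw [Win, wins_decz_iff (ins := instr) (i := i) (a := a) (b := .clear i a) rfl]
    have : update r i 0 = r := by rw [← hk, Function.update_eq_self]
    simp [hk, this]
  | succ k ih =>
    rw [Win, wins_decz_iff (ins := instr) (i := i) (a := a) (b := .clear i a) rfl]
    have := @ih (update r i k) (by simp)
    simp [hk, this]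

/-- A win is a well-founded derivation, so the first player cannot increment forever. The loop only
increases the register, whence the lower bound on `k`. -/
theorem win_guess {i : ℕ} {a : Prog} {r : ℕ → ℕ} :
    (Prog.guess i a).Win r ↔ ∃ k, r i ≤ k ∧ a.Win (update r i k) := by
  constructor
  · intro H
    -- The loop runs through two control states, and the induction on the derivation treats both at
    -- once.
    suffices ∀ P r, Win P r →
        (P = .guess i a → ∃ k, r i ≤ k ∧ a.Win (update r i k)) ∧
        (P = .incr i (.guess i a) → ∃ k, r i ≤ k ∧ a.Win (update r i k)) from (this _ _ H).1 rfl
    intro P r H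
    induction H with
    | @eorLeft l r x y h h' ih =>
      refine ⟨?_, ?_⟩ <;> rintro rfl <;> simp only [instr, Instr.eor.injEq, reduceCtorEq] at h
      exact ⟨r i, le_rfl, by rw [Function.update_eq_self, h.1]; exact h'⟩
    | @eorRight l r x y h h' ih =>
      refine ⟨?_, ?_⟩ <;> rintro rfl <;> simp only [instr, Instr.eor.injEq, reduceCtorEq] at h
      exact ih.2 h.2.symm
    | @incr l r j x h h' ih =>
      refine ⟨?_, ?_⟩ <;> rintro rfl <;> simp only [instr, Instr.incr.injEq, reduceCtorEq] at h
      obtain ⟨rfl, rfl⟩ := h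
      obtain ⟨k, hk, hw⟩ := ih.1 rfl
      simp only [Function.update_self] at hk
      exact ⟨k, by omega, by simpa using hw⟩
    | _ => refine ⟨?_, ?_⟩ <;> rintro rfl <;> simp_all [instr]
  · rintro ⟨k, hk, hw⟩
    obtain ⟨d, rfl⟩ := Nat.exists_eq_add_of_le hk
    clear hk
    induction d generalizing r with
    | zero => exact .eorLeft rfl (by simpa using hw)
    | succ d ih =>
      refine .eorRight rfl (.incr rfl (ih ?_))
      simpa [add_assoc, add_comm 1 d] using hw

theorem win_choose {i : ℕ} {a : Prog} {r : ℕ → ℕ} :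
    (Prog.choose i a).Win r ↔ ∃ k, a.Win (update r i k) := by
  rw [choose, win_clear, win_guess]
  simp

theorem win_eq {i j : ℕ} (hij : i ≠ j) {r : ℕ → ℕ} : (Prog.eq i j).Win r ↔ r i = r j := by
  generalize hk : r i = k
  have h1 : instr (.eq i j) = .decz i (.decz j .win .lose) (.decz j .lose (.eq i j)) := rfl
  have h2 : instr (.decz j .win .lose) = .decz j .win .lose := rfl
  have h3 : instr (.decz j .lose (.eq i j)) = .decz j .lose (.eq i j) := rfl
  have hw : ∀ r, Wins instr .win r := fun r => .win rfl
  have hl : ∀ r, ¬ Wins instr .lose r := fun r => not_wins_of_lose rfl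
  induction k generalizing r with
  | zero =>
    rw [Win, wins_decz_iff h1, wins_decz_iff h2]
    simp [hk, hw, hl, eq_comm]
  | succ k ih =>
    rw [Win, wins_decz_iff h1, wins_decz_iff h3]
    simp only [hk, hl, hij.symm, Function.update_of_ne, ne_eq, not_false_eq_true]
    have := @ih (update (update r i k) j (r j - 1)) (by simp [hij])
    simp only [Nat.add_sub_cancel, Win] at this ⊢
    simp only [this, Function.update_self]
    simp
    omega

/-- `chooseAll ks P` overwrites all registers in `ks`. -/
def chooseAll (ks : List ℕ) (P : Prog) : Prog := ks.foldr choose P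

theorem win_chooseAll {ks : List ℕ} {P : Prog} {r : ℕ → ℕ} :
    (chooseAll ks P).Win r ↔ ∃ r', (∀ i ∉ ks, r' i = r i) ∧ P.Win r' := by
  induction ks generalizing r with
  | nil =>
    simp only [chooseAll, List.foldr_nil, List.not_mem_nil, not_false_eq_true, forall_const]
    exact ⟨fun h => ⟨r, fun _ => rfl, h⟩, fun ⟨r', h, hw⟩ => (funext h : r' = r) ▸ hw⟩
  | cons k ks ih =>
    rw [chooseAll, List.foldr_cons, win_choose]
    change (∃ m, (chooseAll ks P).Win _) ↔ _
    simp only [ih]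
    constructor
    · rintro ⟨m, r', h, hw⟩
      refine ⟨r', fun i hi => ?_, hw⟩
      simp only [List.mem_cons, not_or] at hi
      rw [h i hi.2, Function.update_of_ne hi.1]
    · rintro ⟨r', h, hw⟩
      refine ⟨r' k, r', fun i hi => ?_, hw⟩
      by_cases hik : i = k
      · subst hik; simp
      · rw [Function.update_of_ne hik]
        exact h i (by simp [hik, hi])

/-- The second player chooses one of the programs. -/
def sandAll (Ps : List Prog) : Prog := Ps.foldr sand win

theorem win_sandAll {Ps : List Prog} {r : ℕ → ℕ} :
    (sandAll Ps).Win r ↔ ∀ P ∈ Ps, P.Win r := by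
  induction Ps with
  | nil => simpa [sandAll] using (Wins.win rfl : Wins instr .win r)
  | cons P Ps ih =>
    rw [sandAll, List.foldr_cons, Win, wins_sand_iff (ins := instr) (a := P) (b := sandAll Ps) rfl]
    simp [← ih]

/-- Loops return to the same program, up to the exchange of roles in `natRec`, so only finitely many
programs are reachable. This makes the resulting system finite. -/
theorem exists_finite_closed (P : Prog) :
    ∃ T : Set Prog, T.Finite ∧ P ∈ T ∧ ∀ Q ∈ T, ∀ Q' ∈ Q.instr.succs, Q' ∈ T := by
  induction P with
  | win => exact ⟨{.win}, by simp, by simp, by simp [instr, Instr.succs]⟩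
  | lose => exact ⟨{.lose}, by simp, by simp, by simp [instr, Instr.succs]⟩
  | incr i a iha =>
    obtain ⟨A, hA, haA, hcA⟩ := iha
    refine ⟨insert (.incr i a) A, hA.insert _, by simp, ?_⟩
    rintro Q (rfl | hQ) Q' hQ'
    · simp_all [instr, Instr.succs]
    · exact .inr (hcA Q hQ Q' hQ')
  | clear i a iha =>
    obtain ⟨A, hA, haA, hcA⟩ := iha
    refine ⟨insert (.clear i a) A, hA.insert _, by simp, ?_⟩
    rintro Q (rfl | hQ) Q' hQ'
    · simp [instr, Instr.succs] at hQ'; rcases hQ' with rfl | rfl <;> simp_all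
    · exact .inr (hcA Q hQ Q' hQ')
  | guess i a iha =>
    obtain ⟨A, hA, haA, hcA⟩ := iha
    refine ⟨insert (.guess i a) (insert (.incr i (.guess i a)) A), (hA.insert _).insert _,
      by simp, ?_⟩
    rintro Q (rfl | rfl | hQ) Q' hQ'
    · simp [instr, Instr.succs] at hQ'; rcases hQ' with rfl | rfl <;> simp_all
    · simp [instr, Instr.succs] at hQ'; subst hQ'; simp
    · exact .inr (.inr (hcA Q hQ Q' hQ'))
  | decz i a b iha ihb =>
    obtain ⟨A, hA, haA, hcA⟩ := iha
    obtain ⟨B, hB, hbB, hcB⟩ := ihb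
    refine ⟨insert (.decz i a b) (A ∪ B), (hA.union hB).insert _, by simp, ?_⟩
    rintro Q (rfl | hQ | hQ) Q' hQ'
    · simp [instr, Instr.succs] at hQ'; rcases hQ' with rfl | rfl <;> simp_all
    · exact .inr (.inl (hcA Q hQ Q' hQ'))
    · exact .inr (.inr (hcB Q hQ Q' hQ'))
  | eor a b iha ihb =>
    obtain ⟨A, hA, haA, hcA⟩ := iha
    obtain ⟨B, hB, hbB, hcB⟩ := ihb
    refine ⟨insert (.eor a b) (A ∪ B), (hA.union hB).insert _, by simp, ?_⟩
    rintro Q (rfl | hQ | hQ) Q' hQ'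
    · simp [instr, Instr.succs] at hQ'; rcases hQ' with rfl | rfl <;> simp_all
    · exact .inr (.inl (hcA Q hQ Q' hQ'))
    · exact .inr (.inr (hcB Q hQ Q' hQ'))
  | sand a b iha ihb =>
    obtain ⟨A, hA, haA, hcA⟩ := iha
    obtain ⟨B, hB, hbB, hcB⟩ := ihb
    refine ⟨insert (.sand a b) (A ∪ B), (hA.union hB).insert _, by simp, ?_⟩
    rintro Q (rfl | hQ | hQ) Q' hQ'
    · simp [instr, Instr.succs] at hQ'; rcases hQ' with rfl | rfl <;> simp_all
    · exact .inr (.inl (hcA Q hQ Q' hQ'))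
    · exact .inr (.inr (hcB Q hQ Q' hQ'))
  | eq i j =>
    refine ⟨{.eq i j, .decz j .win .lose, .decz j .lose (.eq i j), .win, .lose}, by simp,
      by simp, ?_⟩
    rintro Q (rfl | rfl | rfl | rfl | rfl) Q' hQ' <;> simp [instr, Instr.succs] at hQ' <;>
      rcases hQ' with rfl | rfl <;> simp
  | search o k g ihg =>
    obtain ⟨A, hA, haA, hcA⟩ := ihg
    let S := Prog.search o k g
    let p₁ := Prog.sand g S
    let p₂ := Prog.incr k p₁
    let p₃ := Prog.guess k p₂
    refine ⟨{S, p₁, p₂, p₃, .incr k p₃, .clear k p₃, .win} ∪ A, .union (by simp) hA,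
      by simp [S], ?_⟩
    intro Q hQ Q' hQ'
    rcases hQ with hQ | hQ
    swap
    · exact .inr (hcA Q hQ Q' hQ')
    rcases hQ with rfl | rfl | rfl | rfl | rfl | rfl | rfl
    all_goals simp [instr, Instr.succs, S, p₁, p₂, p₃, choose] at hQ'
    all_goals rcases hQ' with rfl | rfl <;> simp [S, p₁, p₂, p₃, haA]
  | natRec x o k f f' g g' ihf ihf' ihg ihg' =>
    obtain ⟨A, hA, haA, hcA⟩ := ihf
    obtain ⟨B, hB, hbB, hcB⟩ := ihf'
    obtain ⟨C, hC, hcC, hcC'⟩ := ihg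
    obtain ⟨D, hD, hdD, hcD⟩ := ihg'
    let S := Prog.natRec x o k f f' g g'
    let S' := Prog.natRec x k o f' f g' g
    let p₁ := Prog.sand g S'
    let p₂ := Prog.guess k p₁
    let q₁ := Prog.sand g' S
    let q₂ := Prog.guess o q₁
    refine ⟨{S, S', p₁, p₂, .incr k p₂, .clear k p₂, q₁, q₂, .incr o q₂, .clear o q₂} ∪
      (A ∪ B ∪ (C ∪ D)), .union (by simp) ((hA.union hB).union (hC.union hD)), by simp [S], ?_⟩
    intro Q hQ Q' hQ'
    rcases hQ with hQ | (hQ | hQ) | (hQ | hQ)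
    rotate_left
    · exact .inr (.inl (.inl (hcA Q hQ Q' hQ')))
    · exact .inr (.inl (.inr (hcB Q hQ Q' hQ')))
    · exact .inr (.inr (.inl (hcC' Q hQ Q' hQ')))
    · exact .inr (.inr (.inr (hcD Q hQ Q' hQ')))
    rcases hQ with rfl | rfl | rfl | rfl | rfl | rfl | rfl | rfl | rfl | rfl
    all_goals simp [instr, Instr.succs, S, S', p₁, p₂, q₁, q₂, choose] at hQ'
    all_goals rcases hQ' with rfl | rfl <;> simp [S, S', p₁, p₂, q₁, q₂, haA, hbB, hcC, hdD]

end Prog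

end MultiModeGame

/-! ### Partial recursive functions as winning conditions of programs -/

namespace MultiModeGame

open Function (update)

/-- A relation between vectors and numbers is recognizable if, for every placement of the arguments
in distinct registers, some program is winning exactly when the relation holds. -/
def Recognizable {n : ℕ} (R : List.Vector ℕ n → ℕ → Prop) : Prop :=
  ∀ (ρ : Fin n → ℕ) (o : ℕ), Function.Injective ρ → (∀ i, ρ i ≠ o) →
    ∃ P : Prog, ∀ r, P.Win r ↔ R (List.Vector.ofFn fun i => r (ρ i)) (r o)

namespace Recognizable

theorem of_iff {n : ℕ} {R R' : List.Vector ℕ n → ℕ → Prop} (h : Recognizable R)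
    (H : ∀ v b, R' v b ↔ R v b) : Recognizable R' := by
  have : R' = R := by funext v b; exact propext (H v b)
  exact this ▸ h

theorem zero {n : ℕ} : Recognizable fun (_ : List.Vector ℕ n) b => b = 0 := by
  intro ρ o _ _
  refine ⟨.decz o .win .lose, fun r => ?_⟩
  rw [Prog.Win, wins_decz_iff (ins := Prog.instr) (i := o) (a := .win) (b := .lose) rfl]
  have hw : ∀ r, Wins Prog.instr .win r := fun r => .win rfl
  have hl : ∀ r, ¬ Wins Prog.instr .lose r := fun r => not_wins_of_lose rfl
  simp [hw, hl]

theorem get {n : ℕ} (j : Fin n) : Recognizable fun (v : List.Vector ℕ n) b => b = v.get j := by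
  intro ρ o _ ho
  exact ⟨.eq (ρ j) o, fun r => by rw [Prog.win_eq (ho j)]; simp [eq_comm]⟩

theorem succ : Recognizable fun (v : List.Vector ℕ 1) b => b = v.head.succ := by
  intro ρ o _ ho
  refine ⟨.decz o .lose (.eq (ρ 0) o), fun r => ?_⟩
  rw [Prog.Win, wins_decz_iff (ins := Prog.instr) (i := o) (a := .lose) (b := .eq (ρ 0) o) rfl]
  have hl : ∀ r, ¬ Wins Prog.instr .lose r := fun r => not_wins_of_lose rfl
  have := Prog.win_eq (ho 0) (r := update r o (r o - 1))
  rw [Prog.Win] at this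
  simp only [this, hl, ← List.Vector.get_zero, List.Vector.get_ofFn]
  simp [ho 0]
  omega

theorem exists_fresh (s : Finset ℕ) (n : ℕ) : ∃ k : Fin n → ℕ, Function.Injective k ∧
    ∀ i, k i ∉ s := by
  refine ⟨fun i => s.sup id + 1 + i, fun i j h => Fin.ext (by simpa using h), fun i hi => ?_⟩
  have := Finset.le_sup (f := id) hi
  simp only [id] at this
  omega

/-- The first player writes all intermediate values into fresh registers, and the second player
selects which of the claims about them is tested. -/
theorem comp {m n : ℕ} {F : List.Vector ℕ n → ℕ → Prop} {G : Fin n → List.Vector ℕ m → ℕ → Prop}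
    (hF : Recognizable F) (hG : ∀ i, Recognizable (G i)) :
    Recognizable fun v b => ∃ w : List.Vector ℕ n, (∀ i, G i v (w.get i)) ∧ F w b := by
  intro ρ o hρ ho
  obtain ⟨k, hk, hks⟩ := exists_fresh (insert o (Finset.univ.image ρ)) n
  simp only [Finset.mem_insert, Finset.mem_image, Finset.mem_univ, true_and, not_or,
    not_exists] at hks
  replace hks : ∀ i, k i ≠ o ∧ ∀ j, ρ j ≠ k i := hks
  choose Q hQ using fun i => hG i ρ (k i) hρ fun j => (hks i).2 j
  obtain ⟨P, hP⟩ := hF k o hk fun i => (hks i).1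
  refine ⟨Prog.chooseAll (List.ofFn k) (Prog.sandAll (P :: List.ofFn Q)), fun r => ?_⟩
  rw [Prog.win_chooseAll]
  have hmem : ∀ j, (¬∃ i, k i = j) ↔ ∀ i, k i ≠ j := by simp
  simp only [Prog.win_sandAll, List.mem_cons, forall_eq_or_imp, List.mem_ofFn, hmem, hP,
    forall_exists_index, forall_apply_eq_imp_iff, hQ]
  constructor
  · rintro ⟨r', h, h1, h2⟩
    have e : ∀ i, r' (ρ i) = r (ρ i) := fun i => h _ fun j hj => (hks j).2 i hj.symm
    rw [h o fun i => (hks i).1] at h1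
    simp only [e] at h2
    exact ⟨_, by simpa using h2, h1⟩
  · rintro ⟨w, h1, h2⟩
    classical
    let r' : ℕ → ℕ := fun j => if h : ∃ i, k i = j then w.get h.choose else r j
    have hr : ∀ j, (∀ i, k i ≠ j) → r' j = r j := fun j hj => by simp [r', hj]
    have hr' : ∀ i, r' (k i) = w.get i := fun i => by
      have h : ∃ j, k j = k i := ⟨i, rfl⟩
      simp only [r', h, dif_pos]
      rw [hk h.choose_spec]
    have e : ∀ i, r' (ρ i) = r (ρ i) := fun i => hr _ fun j hj => (hks j).2 i hj.symm
    refine ⟨r', hr, ?_, fun i => ?_⟩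
    · rw [hr o fun i => (hks i).1]
      simpa [hr'] using h2
    · simpa [hr', e] using h1 i

theorem natRec {n : ℕ} {f : List.Vector ℕ n → ℕ} {g : List.Vector ℕ (n + 2) → ℕ}
    (hf : Recognizable fun v b => b = f v) (hg : Recognizable fun v b => b = g v) :
    Recognizable fun (v : List.Vector ℕ (n + 1)) b =>
      b = v.head.rec (f v.tail) fun y IH => g (y ::ᵥ IH ::ᵥ v.tail) := by
  intro ρ o hρ ho
  obtain ⟨k, hks⟩ := Infinite.exists_notMem_finset (insert o (Finset.univ.image ρ))
  simp only [Finset.mem_insert, Finset.mem_image, Finset.mem_univ, true_and, not_or,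
    not_exists] at hks
  obtain ⟨hko, hkρ⟩ : k ≠ o ∧ ∀ i, ρ i ≠ k := hks
  have hρt : Function.Injective fun i : Fin n => ρ i.succ := fun i j h => by
    simpa using hρ h
  have hρ0 : ∀ i : Fin n, ρ i.succ ≠ ρ 0 := fun i h => by simpa using hρ h
  have inj : ∀ a, (∀ i, ρ i ≠ a) →
      Function.Injective (Fin.cons (ρ 0) (Fin.cons a fun i : Fin n => ρ i.succ) :
        Fin (n + 2) → ℕ) := by
    intro a ha
    rw [Fin.cons_injective_iff, Fin.cons_injective_iff]
    refine ⟨?_, ?_, hρt⟩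
    · rintro ⟨i, hi⟩
      induction i using Fin.cases with
      | zero => exact ha 0 (by simpa using hi.symm)
      | succ i => exact hρ0 i (by simpa using hi)
    · rintro ⟨i, hi⟩
      exact ha _ hi
  have out : ∀ a b, (∀ i, ρ i ≠ b) → a ≠ b → ∀ i,
      (Fin.cons (ρ 0) (Fin.cons a fun i : Fin n => ρ i.succ) : Fin (n + 2) → ℕ) i ≠ b := by
    intro a b hb hab i
    induction i using Fin.cases with
    | zero => simpa using hb 0
    | succ i =>
      induction i using Fin.cases with
      | zero => simpa using hab
      | succ i => simpa using hb i.succ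
  obtain ⟨Fo, hFo⟩ := hf _ o hρt fun i => ho _
  obtain ⟨Fk, hFk⟩ := hf _ k hρt fun i => hkρ _
  obtain ⟨Go, hGo⟩ := hg _ o (inj k hkρ) (out k o ho hko)
  obtain ⟨Gk, hGk⟩ := hg _ k (inj o ho) (out o k hkρ (Ne.symm hko))
  -- Each recursive call exchanges the output registers and the two versions of each subprogram, so
  -- the induction on `x` must be uniform in all of them.
  suffices H : ∀ (x : ℕ) (o k : ℕ) (F F' G G' : Prog), (∀ i, ρ i ≠ o) → (∀ i, ρ i ≠ k) → k ≠ o →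
      (∀ r, F.Win r ↔ r o = f (List.Vector.ofFn fun i : Fin n => r (ρ i.succ))) →
      (∀ r, F'.Win r ↔ r k = f (List.Vector.ofFn fun i : Fin n => r (ρ i.succ))) →
      (∀ r, G.Win r ↔ r o = g (List.Vector.ofFn fun i : Fin (n + 2) =>
        r ((Fin.cons (ρ 0) (Fin.cons k fun i : Fin n => ρ i.succ) : Fin (n + 2) → ℕ) i))) →
      (∀ r, G'.Win r ↔ r k = g (List.Vector.ofFn fun i : Fin (n + 2) =>
        r ((Fin.cons (ρ 0) (Fin.cons o fun i : Fin n => ρ i.succ) : Fin (n + 2) → ℕ) i))) →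
      ∀ r, r (ρ 0) = x → ((Prog.natRec (ρ 0) o k F F' G G').Win r ↔
        r o = x.rec (f (List.Vector.ofFn fun i : Fin n => r (ρ i.succ)))
          fun y IH => g (y ::ᵥ IH ::ᵥ List.Vector.ofFn fun i : Fin n => r (ρ i.succ))) by
    refine ⟨.natRec (ρ 0) o k Fo Fk Go Gk, fun r => ?_⟩
    rw [H _ o k Fo Fk Go Gk ho hkρ hko hFo hFk hGo hGk r rfl]
    simp [List.Vector.ofFn]
  intro x
  induction x with
  | zero =>
    intro o k F F' G G' ho hk hko hF hF' hG hG' r hr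
    rw [Prog.Win, wins_decz_iff (ins := Prog.instr) (l := .natRec (ρ 0) o k F F' G G') rfl]
    simpa [hr] using hF r
  | succ x ih =>
    intro o k F F' G G' ho hk hko hF hF' hG hG' r hr
    rw [Prog.Win, wins_decz_iff (ins := Prog.instr) (l := .natRec (ρ 0) o k F F' G G') rfl]
    simp only [hr, Nat.add_sub_cancel, Nat.succ_ne_zero, false_implies, true_and, ne_eq,
      not_false_eq_true, true_implies]
    change Prog.Win _ _ ↔ _
    rw [Prog.win_choose]
    have key : ∀ y, (Prog.sand G (.natRec (ρ 0) k o F' F G' G)).Win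
        (update (update r (ρ 0) x) k y) ↔ _ := fun y =>
      (wins_sand_iff (ins := Prog.instr) (l := .sand G (.natRec (ρ 0) k o F' F G' G)) rfl).trans
        (and_congr (hG _) (ih k o F' F G' G hk ho hko.symm hF' hF hG' hG _ (by simp [hk 0])))
    have e1 : ∀ y, (fun i : Fin n => (update (update r (ρ 0) x) k y) (ρ i.succ)) =
        fun i : Fin n => r (ρ i.succ) := fun y => by
      funext i
      rw [Function.update_of_ne (hk _), Function.update_of_ne (hρ0 i)]
    have e2 : ∀ y, (List.Vector.ofFn fun i : Fin (n + 2) => (update (update r (ρ 0) x) k y)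
        ((Fin.cons (ρ 0) (Fin.cons k fun i : Fin n => ρ i.succ) : Fin (n + 2) → ℕ) i)) =
        x ::ᵥ y ::ᵥ List.Vector.ofFn fun i : Fin n => r (ρ i.succ) := fun y => by
      rw [← e1 y]
      simp [List.Vector.ofFn, hk 0]
    simp only [key, e1, e2]
    simp [hko.symm, (ho 0).symm]

/-- The second player either tests the zero at the output itself, or runs down through the smaller
arguments and tests a positive value announced for one of them. -/
theorem search {n : ℕ} {f : List.Vector ℕ (n + 1) → ℕ} (hf : Recognizable fun v b => b = f v) :
    Recognizable fun (v : List.Vector ℕ n) b =>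
      f (b ::ᵥ v) = 0 ∧ ∀ j < b, f (j ::ᵥ v) ≠ 0 := by
  intro ρ o hρ ho
  obtain ⟨k, hks⟩ := Infinite.exists_notMem_finset (insert o (Finset.univ.image ρ))
  simp only [Finset.mem_insert, Finset.mem_image, Finset.mem_univ, true_and, not_or,
    not_exists] at hks
  obtain ⟨hko, hkρ⟩ : k ≠ o ∧ ∀ i, ρ i ≠ k := hks
  have inj : Function.Injective (Fin.cons o ρ : Fin (n + 1) → ℕ) := by
    rw [Fin.cons_injective_iff]
    exact ⟨fun ⟨i, hi⟩ => ho i hi, hρ⟩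
  obtain ⟨P, hP⟩ := hf (Fin.cons o ρ) k inj fun i => by
    induction i using Fin.cases with
    | zero => simpa using hko.symm
    | succ i => simpa using hkρ i
  have hP' : ∀ r, P.Win r ↔ r k = f (r o ::ᵥ List.Vector.ofFn fun i => r (ρ i)) := fun r => by
    rw [hP r]; simp [List.Vector.ofFn]
  have loop : ∀ b r, r o = b → ((Prog.search o k P).Win r ↔
      ∀ j < b, f (j ::ᵥ List.Vector.ofFn fun i => r (ρ i)) ≠ 0) := by
    intro b
    induction b with
    | zero =>
      intro r hr
      rw [Prog.Win, wins_decz_iff (ins := Prog.instr) (l := .search o k P) rfl]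
      simpa [hr] using (Wins.win rfl : Wins Prog.instr .win r)
    | succ b ih =>
      intro r hr
      rw [Prog.Win, wins_decz_iff (ins := Prog.instr) (l := .search o k P) rfl]
      simp only [hr, Nat.add_sub_cancel, Nat.succ_ne_zero, false_implies, true_and, ne_eq,
        not_false_eq_true, true_implies]
      change Prog.Win _ _ ↔ _
      rw [Prog.win_choose]
      have key : ∀ y, (Prog.incr k (.sand P (.search o k P))).Win
          (update (update r o b) k y) ↔ _ := fun y =>
        (wins_incr_iff (ins := Prog.instr) (l := .incr k (.sand P (.search o k P))) rfl).trans <|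
        (wins_sand_iff (ins := Prog.instr) (l := .sand P (.search o k P)) rfl).trans
        (and_congr (hP' _) (ih _ (by simp [hko.symm])))
      simp only [key]
      simp [hko.symm, hkρ, ho]
      rw [Nat.pos_iff_ne_zero]
      constructor
      · rintro ⟨h0, h⟩ j hj
        rcases hj.eq_or_lt with rfl | hj
        · exact h0
        · exact h j hj
      · exact fun h => ⟨h b le_rfl, fun j hj => h j hj.le⟩
  refine ⟨.sand (.choose k (.decz k P .lose)) (.search o k P), fun r => ?_⟩
  rw [Prog.Win, wins_sand_iff (ins := Prog.instr) (l := .sand _ (.search o k P)) rfl]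
  refine and_congr ?_ (loop _ r rfl)
  refine Prog.win_choose.trans ?_
  have key : ∀ y, (Prog.decz k P .lose).Win (update r k y) ↔ _ := fun y =>
    (wins_decz_iff (ins := Prog.instr) (l := .decz k P .lose) rfl)
  have hl : ∀ r, ¬ Wins Prog.instr .lose r := fun r => not_wins_of_lose rfl
  have hP'' : ∀ r, Wins Prog.instr P r ↔ _ := hP'
  simp only [key, hl, hP'']
  simp [hko.symm, hkρ, eq_comm]

end Recognizable

theorem recognizable_of_primrec' {n : ℕ} {f : List.Vector ℕ n → ℕ} (hf : Nat.Primrec' f) :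
    Recognizable fun v b => b = f v := by
  induction hf with
  | zero => exact Recognizable.zero
  | succ => exact Recognizable.succ
  | get i => exact Recognizable.get i
  | comp g _ _ ihf ihg =>
    refine (Recognizable.comp ihf ihg).of_iff fun v b => ?_
    constructor
    · rintro rfl
      exact ⟨_, fun i => by simp, rfl⟩
    · rintro ⟨w, hw, rfl⟩
      congr 1
      ext i
      simp [hw]
  | prec _ _ ihf ihg => exact Recognizable.natRec ihf ihg

theorem mem_mOfFn {n : ℕ} (p : Fin n → Part ℕ) (w : List.Vector ℕ n) :
    w ∈ List.Vector.mOfFn p ↔ ∀ i, w.get i ∈ p i := by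
  induction n with
  | zero => simp [List.Vector.mOfFn, pure, Part.mem_some_iff, List.Vector.eq_nil]
  | succ n ih =>
    simp only [List.Vector.mOfFn, Part.bind_eq_bind, Part.mem_bind_iff, ih]
    constructor
    · rintro ⟨a, ha, v, hv, hw⟩
      have hw : w = a ::ᵥ v := by simpa [pure] using hw
      subst hw
      intro i
      induction i using Fin.cases with
      | zero => simpa using ha
      | succ i => simpa using hv i
    · intro h
      refine ⟨w.head, by simpa using h 0, w.tail, fun i => by simpa using h i.succ, ?_⟩
      simp [pure]

theorem recognizable_of_partrec' {n : ℕ} {f : List.Vector ℕ n →. ℕ} (hf : Nat.Partrec' f) :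
    Recognizable fun v b => b ∈ f v := by
  induction hf with
  | prim hf =>
    refine (recognizable_of_primrec' hf).of_iff fun v b => ?_
    simp
  | comp g _ _ ihf ihg =>
    refine (Recognizable.comp ihf ihg).of_iff fun v b => ?_
    refine Part.mem_bind_iff.trans (exists_congr fun w => ?_)
    exact and_congr_left' (mem_mOfFn (fun i => g i v) w)
  | @rfind n f _ ihf =>
    refine (Recognizable.search (f := f) (ihf.of_iff fun v b => by simp)).of_iff fun v b => ?_
    refine Nat.mem_rfind.trans ?_
    simp [eq_comm]

/-- The domain of a partial recursive function is described by a program: the argument is in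
register `0`. -/
theorem exists_prog_of_partrec {f : ℕ →. ℕ} (hf : Partrec f) :
    ∃ P : Prog, ∀ n, P.Win (update 0 0 n) ↔ (f n).Dom := by
  obtain ⟨P, hP⟩ := recognizable_of_partrec' (Nat.Partrec'.part_iff₁.2 hf) (fun _ => 0) 1
    (fun i j _ => Subsingleton.elim i j) (by simp)
  refine ⟨.choose 1 P, fun n => ?_⟩
  rw [Prog.win_choose]
  simp only [hP, Part.dom_iff_mem]
  simp [List.Vector.ofFn]

end MultiModeGame

namespace MultiModeGame

open Filter Topology

/-! ### Games on a real number

In a control state `q` with a number `u`, the second player picks an option and a new number `u'`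
that should be an affine image of `u`. The first player objects if `u'` is wrong, and otherwise
chooses one of two successors of the option. -/

/-- An option of the second player in a game on a real number: the factor, whether the input is
added, whether the new number has to be `0` or `1`, and the two successors, where `none` is the
state in which the second player has won. -/
structure Opt (Q : Type) : Type where
  mult : ℚ
  inp : Bool
  fix : Option (Fin 2)
  next : Fin 2 → Option Q

variable {Q : Type}

/-- The correct new number. -/
noncomputable def Opt.image (o : Opt Q) (β u : ℝ) : ℝ := o.mult * u + if o.inp then β else 0

/-- The new numbers that the option permits at all. -/
def Opt.Allowed (o : Opt Q) (u : ℝ) : Prop := 0 ≤ u ∧ u ≤ 1 ∧ ∀ k ∈ o.fix, u = ((k : ℕ) : ℝ)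

/-- Closedness ensures that an option whose exact image is forbidden stays forbidden under small
errors. -/
theorem Opt.isClosed_allowed (o : Opt Q) : IsClosed {u | o.Allowed u} := by
  have h : IsClosed {u : ℝ | ∀ k ∈ o.fix, u = ((k : ℕ) : ℝ)} := by
    simp only [Set.ofPred_forall]
    exact isClosed_iInter fun k => isClosed_iInter fun _ => isClosed_eq continuous_id continuous_const
  exact (isClosed_le continuous_const continuous_id).inter
    ((isClosed_le continuous_id continuous_const).inter h)

/-- The first player wins when the new numbers have to be exact. -/
inductive ExactWin (opts : Q → List (Opt Q)) (β : ℝ) : Q → ℝ → Prop where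
  | intro {q u} (a : Opt Q → Fin 2) (q' : Opt Q → Q) :
      (∀ o ∈ opts q, o.Allowed (o.image β u) → o.next (a o) = some (q' o)) →
      (∀ o ∈ opts q, o.Allowed (o.image β u) → ExactWin opts β (q' o) (o.image β u)) →
      ExactWin opts β q u

/-- The first player wins even if the new numbers may differ from the correct ones by less
than `η`. -/
inductive RobustWin (opts : Q → List (Opt Q)) (β η : ℝ) : Q → ℝ → Prop where
  | intro {q u} (a : Opt Q → ℝ → Fin 2) (q' : Opt Q → ℝ → Q) :
      (∀ o ∈ opts q, ∀ u', o.Allowed u' → |u' - o.image β u| < η →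
        o.next (a o u') = some (q' o u')) →
      (∀ o ∈ opts q, ∀ u', o.Allowed u' → |u' - o.image β u| < η →
        RobustWin opts β η (q' o u') u') →
      RobustWin opts β η q u

/-- The second player wins if the new numbers may differ from the correct ones by less than `η`. -/
inductive SecondWin (opts : Q → List (Opt Q)) (β η : ℝ) : Option Q → ℝ → Prop where
  | accept {u} : SecondWin opts β η none u
  | step {q u} (o : Opt Q) (u' : ℝ) : o ∈ opts q → o.Allowed u' → |u' - o.image β u| < η →
      (∀ a, SecondWin opts β η (o.next a) u') → SecondWin opts β η (some q) u

variable {opts : Q → List (Opt Q)} {β : ℝ}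

theorem ExactWin.of_forall {q : Q} {u : ℝ}
    (h : ∀ o ∈ opts q, o.Allowed (o.image β u) →
      ∃ a q', o.next a = some q' ∧ ExactWin opts β q' (o.image β u)) : ExactWin opts β q u := by
  have h' : ∀ o, ∃ a q', o ∈ opts q → o.Allowed (o.image β u) →
      o.next a = some q' ∧ ExactWin opts β q' (o.image β u) := fun o => by
    by_cases ho : o ∈ opts q ∧ o.Allowed (o.image β u)
    · obtain ⟨a, q', h⟩ := h o ho.1 ho.2
      exact ⟨a, q', fun _ _ => h⟩
    · exact ⟨0, q, fun h1 h2 => absurd ⟨h1, h2⟩ ho⟩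
  choose a q' h' using h'
  exact .intro a q' (fun o ho ha => (h' o ho ha).1) fun o ho ha => (h' o ho ha).2

theorem RobustWin.of_forall {η : ℝ} {q : Q} {u : ℝ}
    (h : ∀ o ∈ opts q, ∀ u', o.Allowed u' → |u' - o.image β u| < η →
      ∃ a q', o.next a = some q' ∧ RobustWin opts β η q' u') : RobustWin opts β η q u := by
  have h' : ∀ o u', ∃ a q', o ∈ opts q → o.Allowed u' → |u' - o.image β u| < η →
      o.next a = some q' ∧ RobustWin opts β η q' u' := fun o u' => by
    by_cases ho : o ∈ opts q ∧ o.Allowed u' ∧ |u' - o.image β u| < η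
    · obtain ⟨a, q', h⟩ := h o ho.1 u' ho.2.1 ho.2.2
      exact ⟨a, q', fun _ _ _ => h⟩
    · exact ⟨0, q, fun h1 h2 h3 => absurd ⟨h1, h2, h3⟩ ho⟩
  choose a q' h' using h'
  exact .intro a q' (fun o ho u' ha hu => (h' o u' ho ha hu).1)
    fun o ho u' ha hu => (h' o u' ho ha hu).2

theorem RobustWin.exists_next {η : ℝ} {q : Q} {u : ℝ} (h : RobustWin opts β η q u) {o : Opt Q}
    (ho : o ∈ opts q) {u' : ℝ} (ha : o.Allowed u') (hu : |u' - o.image β u| < η) :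
    ∃ a q', o.next a = some q' ∧ RobustWin opts β η q' u' := by
  obtain ⟨a, q', h1, h2⟩ := h
  exact ⟨_, _, h1 o ho u' ha hu, h2 o ho u' ha hu⟩

theorem RobustWin.mono {η η' : ℝ} (hη : η' ≤ η) {q : Q} {u : ℝ} (h : RobustWin opts β η q u) :
    RobustWin opts β η' q u := by
  induction h with
  | intro a q' h1 _ ih =>
    exact .intro a q' (fun o ho u' ha hu => h1 o ho u' ha (hu.trans_le hη))
      fun o ho u' ha hu => ih o ho u' ha (hu.trans_le hη)

/-- Induction on the winning tree: each node has finitely many options, so finitely many conditions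
on small `η` have to hold together. The position is perturbed along with the tolerance, because
errors are passed on to later rounds. -/
theorem ExactWin.eventually_robustWin {q : Q} {u : ℝ} (h : ExactWin opts β q u) :
    ∀ᶠ η in 𝓝[>] (0 : ℝ), ∀ v, |v - u| ≤ η → RobustWin opts β η q v := by
  induction h with
  | @intro q u a q' h1 _ ih =>
    have main : ∀ o ∈ opts q, ∀ᶠ η in 𝓝[>] (0 : ℝ), ∀ v, |v - u| ≤ η → ∀ u', o.Allowed u' →
        |u' - o.image β v| < η → ∃ a q', o.next a = some q' ∧ RobustWin opts β η q' u' := by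
      intro o ho
      -- An error of `η` in the position is multiplied by the factor of the option, and the new
      -- number adds another `η`. Since `C ≥ 1`, a win with tolerance `C * η` is also one with
      -- tolerance `η`.
      set C : ℝ := |(o.mult : ℝ)| + 1 with hC
      have hC1 : 1 ≤ C := by have := abs_nonneg (o.mult : ℝ); linarith
      have lim : Tendsto (fun η : ℝ => C * η) (𝓝[>] 0) (𝓝[>] 0) := by
        refine tendsto_nhdsWithin_iff.2 ⟨?_, ?_⟩
        · have : Tendsto (fun η : ℝ => C * η) (𝓝 0) (𝓝 (C * 0)) := tendsto_id.const_mul C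
          rw [mul_zero] at this
          exact this.mono_left nhdsWithin_le_nhds
        · filter_upwards [self_mem_nhdsWithin] with η hη
          exact mul_pos (lt_of_lt_of_le one_pos hC1) hη
      have dist : ∀ η v u' : ℝ, |v - u| ≤ η → |u' - o.image β v| < η →
          |u' - o.image β u| ≤ C * η := by
        intro η v u' hv hu'
        have e : u' - o.image β u = (u' - o.image β v) + o.mult * (v - u) := by
          simp only [Opt.image]; ring
        rw [e]
        refine (abs_add_le _ _).trans ?_
        rw [abs_mul]
        have := mul_le_mul_of_nonneg_left hv (abs_nonneg (o.mult : ℝ))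
        rw [hC]
        linarith
      by_cases hall : o.Allowed (o.image β u)
      · filter_upwards [lim.eventually (ih o ho hall), self_mem_nhdsWithin] with η hη hpos v hv u'
          ha hu
        have hpos : 0 < η := hpos
        exact ⟨_, _, h1 o ho hall, (hη u' (dist η v u' hv hu)).mono (by nlinarith)⟩
      · obtain ⟨θ, hθ, hball⟩ := Metric.isOpen_iff.1 o.isClosed_allowed.isOpen_compl _ hall
        have : ∀ᶠ η in 𝓝[>] (0 : ℝ), C * η < θ :=
          (tendsto_nhds_of_tendsto_nhdsWithin lim).eventually_lt_const hθ
        filter_upwards [this] with η hη v hv u' ha hu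
        refine absurd ha (hball ?_)
        rw [Metric.mem_ball, Real.dist_eq]
        exact (dist η v u' hv hu).trans_lt hη
    have := (Filter.eventually_all_finite (opts q).finite_toSet).2 main
    filter_upwards [this] with η hη v hv
    exact .of_forall fun o ho u' ha hu => hη o ho v hv u' ha hu

theorem ExactWin.exists_robustWin {q : Q} {u : ℝ} (h : ExactWin opts β q u) :
    ∃ η, 0 < η ∧ RobustWin opts β η q u := by
  obtain ⟨η, h1, h2⟩ := (h.eventually_robustWin.and self_mem_nhdsWithin).exists
  have h2 : 0 < η := h2
  exact ⟨η, h2, h1 u (by simpa using h2.le)⟩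

end MultiModeGame

namespace MultiModeGame

open Function (update)

/-! ### From registers to a real number

The registers `r` are represented by the number `1 / (2 ^ t * ∏ i, pᵢ ^ rᵢ)`, where the `pᵢ` are the
odd primes and `t` is arbitrary. -/

/-- The odd primes. -/
noncomputable def oddPrime (i : ℕ) : ℕ := Nat.nth Nat.Prime (i + 1)

theorem prime_oddPrime (i : ℕ) : (oddPrime i).Prime := Nat.prime_nth_prime _

theorem oddPrime_injective : Function.Injective oddPrime := fun i j h => by
  simpa using Nat.nth_injective Nat.infinite_setOfPred_prime h

theorem oddPrime_ne_two (i : ℕ) : oddPrime i ≠ 2 := fun h => by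
  rw [← Nat.nth_prime_zero_eq_two] at h
  simpa using Nat.nth_injective Nat.infinite_setOfPred_prime h

/-- The denominator of the number that represents the registers `r`. -/
noncomputable def regCode (R t : ℕ) (r : ℕ → ℕ) : ℕ := 2 ^ t * ∏ i ∈ Finset.range R, oddPrime i ^ r i

theorem regCode_pos (R t : ℕ) (r : ℕ → ℕ) : 0 < regCode R t r :=
  Nat.mul_pos (by positivity) (Finset.prod_pos fun i _ => pow_pos (prime_oddPrime i).pos _)

theorem regCode_succ (R t : ℕ) (r : ℕ → ℕ) : regCode R (t + 1) r = 2 * regCode R t r := by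
  rw [regCode, regCode, pow_succ]; ring

theorem regCode_add (R t s : ℕ) (r : ℕ → ℕ) : regCode R (t + s) r = 2 ^ s * regCode R t r := by
  rw [regCode, regCode, pow_add]; ring

theorem regCode_update {R i : ℕ} (hi : i < R) (t k : ℕ) (r : ℕ → ℕ) :
    regCode R t (update r i (k + 1)) = oddPrime i * regCode R t (update r i k) := by
  have h : i ∈ Finset.range R := Finset.mem_range.2 hi
  have e : ∀ k, ∏ j ∈ Finset.range R, oddPrime j ^ update r i k j =
      oddPrime i ^ k * ∏ j ∈ (Finset.range R).erase i, oddPrime j ^ r j := fun k => by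
    rw [← Finset.mul_prod_erase _ _ h, Function.update_self]
    congr 1
    exact Finset.prod_congr rfl fun j hj => by
      rw [Function.update_of_ne (Finset.ne_of_mem_erase hj)]
  rw [regCode, regCode, e, e, pow_succ]
  ring

theorem regCode_incr {R i : ℕ} (hi : i < R) (t : ℕ) (r : ℕ → ℕ) :
    regCode R t (update r i (r i + 1)) = oddPrime i * regCode R t r := by
  rw [regCode_update hi, Function.update_eq_self]

theorem regCode_decr {R i : ℕ} (hi : i < R) (t : ℕ) {r : ℕ → ℕ} (h0 : r i ≠ 0) :
    regCode R t r = oddPrime i * regCode R t (update r i (r i - 1)) := by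
  rw [← regCode_update hi, Nat.sub_add_cancel (Nat.one_le_iff_ne_zero.2 h0),
    Function.update_eq_self]

theorem oddPrime_not_dvd_regCode (R t : ℕ) {r : ℕ → ℕ} {i : ℕ} (h0 : r i = 0) :
    ¬ oddPrime i ∣ regCode R t r := by
  have hp := prime_oddPrime i
  rw [regCode, hp.dvd_mul, hp.prime.dvd_finsetProd_iff]
  rintro (h | ⟨j, -, h⟩)
  · exact oddPrime_ne_two i ((Nat.prime_dvd_prime_iff_eq hp Nat.prime_two).1 (hp.dvd_of_dvd_pow h))
  · have := (Nat.prime_dvd_prime_iff_eq hp (prime_oddPrime j)).1 (hp.dvd_of_dvd_pow h)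
    have := oddPrime_injective this
    subst this
    rw [h0, pow_zero] at h
    exact hp.one_lt.ne' (Nat.dvd_one.1 h)

/-- `2` and the odd primes that belong to registers below `R` other than `ex`. -/
noncomputable def stripPrimes (R : ℕ) (ex : Option ℕ) : List ℕ :=
  2 :: ((List.range R).filter fun i => some i ≠ ex).map oddPrime

theorem mem_stripPrimes {R : ℕ} {ex : Option ℕ} {p : ℕ} :
    p ∈ stripPrimes R ex ↔ p = 2 ∨ ∃ i < R, some i ≠ ex ∧ oddPrime i = p := by
  simp [stripPrimes, and_assoc]

theorem prime_of_mem_stripPrimes {R : ℕ} {ex : Option ℕ} {p : ℕ} (h : p ∈ stripPrimes R ex) :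
    p.Prime := by
  rcases mem_stripPrimes.1 h with rfl | ⟨i, -, -, rfl⟩
  exacts [Nat.prime_two, prime_oddPrime i]

/-- The products of the primes in `stripPrimes R ex`. -/
def stripMonoid (R : ℕ) (ex : Option ℕ) : Submonoid ℕ :=
  Submonoid.closure {p | p ∈ stripPrimes R ex}

theorem mem_stripMonoid {R : ℕ} {ex : Option ℕ} {p : ℕ} (h : p ∈ stripPrimes R ex) :
    p ∈ stripMonoid R ex :=
  Submonoid.subset_closure (Set.mem_ofPred_eq ▸ h : p ∈ {p | p ∈ stripPrimes R ex})

theorem pos_of_mem_stripMonoid {R : ℕ} {ex : Option ℕ} {N : ℕ} (h : N ∈ stripMonoid R ex) :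
    0 < N := by
  induction h using Submonoid.closure_induction with
  | mem p hp => exact (prime_of_mem_stripPrimes hp).pos
  | one => exact one_pos
  | mul _ _ _ _ ha hb => exact Nat.mul_pos ha hb

theorem not_dvd_of_mem_stripMonoid {R i N : ℕ} (h : N ∈ stripMonoid R (some i)) :
    ¬ oddPrime i ∣ N := by
  induction h using Submonoid.closure_induction with
  | mem p hp =>
    rw [Nat.prime_dvd_prime_iff_eq (prime_oddPrime i) (prime_of_mem_stripPrimes hp)]
    rcases mem_stripPrimes.1 hp with rfl | ⟨j, -, hj, rfl⟩
    · exact oddPrime_ne_two i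
    · exact fun e => hj (congrArg some (oddPrime_injective e).symm)
  | one => exact fun h => (prime_oddPrime i).one_lt.ne' (Nat.dvd_one.1 h)
  | mul a b _ _ ha hb => exact fun h => ((prime_oddPrime i).dvd_mul.1 h).elim ha hb

theorem regCode_mem_stripMonoid (R t : ℕ) {r : ℕ → ℕ} {ex : Option ℕ}
    (h : ∀ i ∈ ex, r i = 0) : regCode R t r ∈ stripMonoid R ex := by
  refine mul_mem (pow_mem (mem_stripMonoid (mem_stripPrimes.2 (.inl rfl))) _)
    (prod_mem fun i hi => ?_)
  by_cases he : some i = ex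
  · rw [h i (by simp [← he]), pow_zero]
    exact one_mem _
  · exact pow_mem (mem_stripMonoid
      (mem_stripPrimes.2 (.inr ⟨i, Finset.mem_range.1 hi, he, rfl⟩))) _

/-! ### The game on a real number that simulates a register machine -/

/-- The control states of the game that simulates an alternating register machine. In `strip ex` the
second player claims that the current number is the reciprocal of an element of
`stripMonoid R ex`. -/
inductive SimState (Λ : Type) : Type where
  | init
  | prog (l : Λ)
  | strip (ex : Option ℕ)

variable {Λ : Type}

/-- Options that simulate an instruction. -/
noncomputable def instrOpts : Instr Λ → List (Opt (SimState Λ))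
  | .win => []
  | .lose => [⟨1 / 2, false, none, fun _ => none⟩]
  | .incr i a => [⟨1 / oddPrime i, false, none, fun _ => some (.prog a)⟩]
  -- The second player asserts the outcome of the test, and the first player either goes on or
  -- challenges. A challenged zero claim must be defended without the prime of register `i`. A
  -- challenged nonzero claim must show that the number is still the reciprocal of an integer after
  -- multiplication by that prime; the power of two only makes the factor at most `1 / 2`.
  | .decz i a b =>
    [⟨1 / 2, false, none, ![some (.prog a), some (.strip (some i))]⟩,
      ⟨oddPrime i / 2 ^ oddPrime i, false, none, ![some (.prog b), some (.strip none)]⟩]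
  | .eor a b => [⟨1 / 2, false, none, ![some (.prog a), some (.prog b)]⟩]
  | .sand a b => [⟨1 / 2, false, none, fun _ => some (.prog a)⟩,
      ⟨1 / 2, false, none, fun _ => some (.prog b)⟩]

/-- The second player claims that the number is `k`. -/
def claimOpt (Q : Type) (k : Fin 2) : Opt Q := ⟨1, false, some k, fun _ => none⟩

/-- The options of the game that simulates an alternating register machine. -/
noncomputable def simOpts (R : ℕ) (start : Λ) (ins : Λ → Instr Λ) :
    SimState Λ → List (Opt (SimState Λ))
  | .init => [⟨0, true, none, fun _ => some (.prog start)⟩]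
  | .prog l => claimOpt _ 0 :: instrOpts (ins l)
  | .strip ex => claimOpt _ 1 ::
      (stripPrimes R ex).map fun p : ℕ => ⟨(p : ℚ), false, none, fun _ => some (.strip ex)⟩

section Sim

variable {R : ℕ} {start : Λ} {ins : Λ → Instr Λ} {β : ℝ}

/-- Each multiplication at least doubles the number while it must stay at most `1`, so the stripping
ends. It never hits `1` exactly, since then the product of the primes used would be a forbidden `N`.
-/
theorem exactWin_strip {ex : Option ℕ} {u : ℝ} (hu : 0 < u)
    (h : ∀ N ∈ stripMonoid R ex, u * N ≠ 1) :
    ExactWin (simOpts R start ins) β (.strip ex) u := by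
  obtain ⟨n, hn⟩ := pow_unbounded_of_one_lt u⁻¹ (one_lt_two : (1 : ℝ) < 2)
  replace hn : 1 < u * 2 ^ n := by
    rwa [inv_lt_iff_one_lt_mul₀ hu, mul_comm] at hn
  induction n generalizing u with
  | zero =>
    refine .of_forall fun o ho ha => ?_
    rw [pow_zero, mul_one] at hn
    rcases List.mem_cons.1 ho with rfl | ho
    · have := ha.2.1
      simp only [claimOpt, Opt.image, Rat.cast_one, one_mul, Bool.false_eq_true, if_false,
        add_zero] at this
      linarith
    · obtain ⟨p, hp, rfl⟩ := List.mem_map.1 ho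
      have := ha.2.1
      have h2 : (2 : ℝ) ≤ p := by exact_mod_cast (prime_of_mem_stripPrimes hp).two_le
      simp [Opt.image] at this
      nlinarith
  | succ n ih =>
    refine .of_forall fun o ho ha => ?_
    rcases List.mem_cons.1 ho with rfl | ho
    · have := ha.2.2 1 rfl
      simp [claimOpt, Opt.image] at this
      exact absurd this (by simpa using h 1 (one_mem _))
    · obtain ⟨p, hp, rfl⟩ := List.mem_map.1 ho
      have h2 : (2 : ℝ) ≤ p := by exact_mod_cast (prime_of_mem_stripPrimes hp).two_le
      refine ⟨0, _, rfl, ?_⟩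
      have e : Opt.image (⟨p, false, none, fun _ => some (.strip ex)⟩ : Opt (SimState Λ)) β u =
          p * u := by simp [Opt.image]
      rw [e]
      refine ih (by positivity) (fun N hN he => ?_) ?_
      · refine h (p * N) (mul_mem (mem_stripMonoid hp) hN) ?_
        rw [← he]; push_cast; ring
      · rw [pow_succ] at hn
        have : 0 < u * 2 ^ n := by positivity
        nlinarith

theorem secondWin_strip {η : ℝ} (hη : 0 < η) {ex : Option ℕ} {N : ℕ} (h : N ∈ stripMonoid R ex) :
    SecondWin (simOpts R start ins) β η (some (.strip ex)) (1 / N) := by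
  induction h using Submonoid.closure_induction_left with
  | one =>
    exact .step (claimOpt _ 1) 1 (by simp [simOpts]) (by simp [Opt.Allowed, claimOpt])
      (by simpa [Opt.image, claimOpt] using hη) fun _ => .accept
  | mul_left p hp M hM ih =>
    have hp0 : (p : ℝ) ≠ 0 := by exact_mod_cast (prime_of_mem_stripPrimes hp).ne_zero
    have hM1 : (1 : ℝ) ≤ M := by exact_mod_cast pos_of_mem_stripMonoid hM
    refine .step ⟨p, false, none, fun _ => some (.strip ex)⟩ (1 / M) ?_ ?_ ?_ fun _ => ih
    · exact List.mem_cons_of_mem _ (List.mem_map.2 ⟨p, hp, rfl⟩)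
    · exact ⟨by positivity, by rw [div_le_one (by linarith)]; exact hM1, by simp⟩
    · have : (p : ℝ) * (1 / ((p * M : ℕ) : ℝ)) = 1 / M := by
        push_cast; field_simp
      simp only [Opt.image, Rat.cast_natCast, this]
      simpa using hη

/-- A set of control states that is closed under successors and uses registers below `R` only. -/
structure IsControlSet (ins : Λ → Instr Λ) (R : ℕ) (T : Set Λ) : Prop where
  succs_mem : ∀ l ∈ T, ∀ l' ∈ (ins l).succs, l' ∈ T
  lt : ∀ l ∈ T, ∀ i, (ins l).Uses i → i < R

variable {T : Set Λ}

theorem one_div_regCode_pos (R t : ℕ) (r : ℕ → ℕ) : 0 < (1 / regCode R t r : ℝ) :=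
  one_div_pos.2 (by exact_mod_cast regCode_pos R t r)

theorem one_div_regCode_le_one (R t : ℕ) (r : ℕ → ℕ) : (1 / regCode R t r : ℝ) ≤ 1 := by
  rw [div_le_one (by exact_mod_cast regCode_pos R t r)]
  exact_mod_cast regCode_pos R t r

theorem half_mul_regCode (R t : ℕ) (r : ℕ → ℕ) :
    ((1 / 2 : ℚ) : ℝ) * (1 / regCode R t r) = 1 / regCode R (t + 1) r := by
  rw [regCode_succ]; push_cast; field_simp

theorem incr_mul_regCode {i : ℕ} (hi : i < R) (t : ℕ) (r : ℕ → ℕ) :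
    ((1 / oddPrime i : ℚ) : ℝ) * (1 / regCode R t r) =
      1 / regCode R t (update r i (r i + 1)) := by
  rw [regCode_incr hi]; push_cast; field_simp

theorem decr_mul_regCode {i : ℕ} (hi : i < R) (t : ℕ) {r : ℕ → ℕ} (h0 : r i ≠ 0) :
    ((oddPrime i / 2 ^ oddPrime i : ℚ) : ℝ) * (1 / regCode R t r) =
      1 / regCode R (t + oddPrime i) (update r i (r i - 1)) := by
  have := (prime_oddPrime i).ne_zero
  rw [regCode_decr hi t h0, regCode_add]; push_cast; field_simp

/-- In the exact game the claim that a positive number is `0` is never permitted, so only the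
options of the instruction matter. -/
theorem exactWin_prog_of_instrOpts {l : Λ} {u : ℝ} (hu : 0 < u)
    (H : ∀ o ∈ instrOpts (ins l), ∃ a q', o.next a = some q' ∧
      ExactWin (simOpts R start ins) β q' (o.mult * u) ∧ o.inp = false) :
    ExactWin (simOpts R start ins) β (.prog l) u := by
  refine .of_forall fun o ho ha => ?_
  rcases List.mem_cons.1 ho with rfl | ho
  · have := ha.2.2 0 rfl
    simp [claimOpt, Opt.image] at this
    exact absurd this hu.ne'
  · obtain ⟨a, q', h1, h2, h3⟩ := H o ho
    exact ⟨a, q', h1, by simpa [Opt.image, h3] using h2⟩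

theorem exactWin_prog (hT : IsControlSet ins R T) {l : Λ} {r : ℕ → ℕ} (h : Wins ins l r)
    (hl : l ∈ T) (t : ℕ) :
    ExactWin (simOpts R start ins) β (.prog l) (1 / regCode R t r) := by
  induction h generalizing t with
  | win h =>
    exact exactWin_prog_of_instrOpts (one_div_regCode_pos _ _ _) (by simp [h, instrOpts])
  | @incr l r i a h _ ih =>
    have hi := hT.lt l hl i (by simp [h, Instr.Uses])
    have ha := hT.succs_mem l hl a (by simp [h, Instr.succs])
    refine exactWin_prog_of_instrOpts (one_div_regCode_pos _ _ _) ?_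
    simp only [h, instrOpts, List.mem_singleton, forall_eq]
    exact ⟨0, _, rfl, by rw [incr_mul_regCode hi]; exact ih ha t, trivial⟩
  | @deczZero l r i a b h h0 _ ih =>
    have hi := hT.lt l hl i (by simp [h, Instr.Uses])
    have ha := hT.succs_mem l hl a (by simp [h, Instr.succs])
    refine exactWin_prog_of_instrOpts (one_div_regCode_pos _ _ _) ?_
    simp only [h, instrOpts, List.mem_cons, List.not_mem_nil, or_false, forall_eq_or_imp, forall_eq]
    refine ⟨⟨0, _, rfl, by rw [half_mul_regCode]; exact ih ha _, trivial⟩, 1, _, rfl, ?_, trivial⟩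
    have hp := (prime_oddPrime i).pos
    -- If a false nonzero claim could be defended with `N`, then `oddPrime i * N` would equal `2 ^
    -- oddPrime i` times the code, whose exponent at this prime is zero.
    refine exactWin_strip (mul_pos (by push_cast; positivity) (one_div_regCode_pos _ _ _))
      fun N _ e => oddPrime_not_dvd_regCode R (t + oddPrime i) h0 ⟨N, ?_⟩
    have hpos := regCode_pos R t r
    rw [regCode_add]
    push_cast at e
    field_simp at e
    exact_mod_cast e.symm
  | @deczSucc l r i a b h h0 _ ih =>
    have hi := hT.lt l hl i (by simp [h, Instr.Uses])
    have hb := hT.succs_mem l hl b (by simp [h, Instr.succs])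
    refine exactWin_prog_of_instrOpts (one_div_regCode_pos _ _ _) ?_
    simp only [h, instrOpts, List.mem_cons, List.not_mem_nil, or_false, forall_eq_or_imp, forall_eq]
    refine ⟨⟨1, _, rfl, ?_, trivial⟩,
      0, _, rfl, by rw [decr_mul_regCode hi t h0]; exact ih hb _, trivial⟩
    rw [half_mul_regCode]
    -- A false zero claim would need `N` equal to the code itself, which the excluded prime divides.
    refine exactWin_strip (one_div_regCode_pos _ _ _) fun N hN e => not_dvd_of_mem_stripMonoid hN ?_
    have hpos := regCode_pos R (t + 1) r
    field_simp at e
    have e : N = regCode R (t + 1) r := by exact_mod_cast e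
    rw [e, regCode_decr hi _ h0]
    exact dvd_mul_right _ _
  | @eorLeft l r a b h _ ih =>
    have ha := hT.succs_mem l hl a (by simp [h, Instr.succs])
    refine exactWin_prog_of_instrOpts (one_div_regCode_pos _ _ _) ?_
    simp only [h, instrOpts, List.mem_singleton, forall_eq]
    exact ⟨0, _, rfl, by rw [half_mul_regCode]; exact ih ha _, trivial⟩
  | @eorRight l r a b h _ ih =>
    have hb := hT.succs_mem l hl b (by simp [h, Instr.succs])
    refine exactWin_prog_of_instrOpts (one_div_regCode_pos _ _ _) ?_
    simp only [h, instrOpts, List.mem_singleton, forall_eq]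
    exact ⟨1, _, rfl, by rw [half_mul_regCode]; exact ih hb _, trivial⟩
  | @sand l r a b h _ _ ih1 ih2 =>
    have ha := hT.succs_mem l hl a (by simp [h, Instr.succs])
    have hb := hT.succs_mem l hl b (by simp [h, Instr.succs])
    refine exactWin_prog_of_instrOpts (one_div_regCode_pos _ _ _) ?_
    simp only [h, instrOpts, List.mem_cons, List.not_mem_nil, or_false, forall_eq_or_imp, forall_eq]
    exact ⟨⟨0, _, rfl, by rw [half_mul_regCode]; exact ih1 ha _, trivial⟩,
      0, _, rfl, by rw [half_mul_regCode]; exact ih2 hb _, trivial⟩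

theorem secondWin_prog_step {η : ℝ} (hη : 0 < η) {l : Λ} {u v : ℝ} (o : Opt (SimState Λ))
    (ho : o ∈ instrOpts (ins l)) (hfix : o.fix = none) (hinp : o.inp = false)
    (huv : o.mult * u = v) (hv0 : 0 < v) (hv1 : v ≤ 1)
    (h : ∀ a, SecondWin (simOpts R start ins) β η (o.next a) v) :
    SecondWin (simOpts R start ins) β η (some (.prog l)) u := by
  refine .step o v (List.mem_cons_of_mem _ ho) ⟨hv0.le, hv1, by simp [hfix]⟩ ?_ h
  simpa [Opt.image, hinp, huv] using hη

/-- Honest play keeps the machine position lost for the first player and at least halves the number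
in each round; `n` bounds the rounds until it falls below `η`. -/
theorem secondWin_prog (hT : IsControlSet ins R T) {η : ℝ} (hη : 0 < η) (n : ℕ) {l : Λ}
    {r : ℕ → ℕ} (h : ¬ Wins ins l r) (hl : l ∈ T) (t : ℕ)
    (hn : (1 / regCode R t r : ℝ) < η * 2 ^ n) :
    SecondWin (simOpts R start ins) β η (some (.prog l)) (1 / regCode R t r) := by
  induction n generalizing l r t with
  | zero =>
    -- The number is now below the tolerance and passes for `0`.
    refine .step (claimOpt _ 0) 0 (by simp [simOpts]) (by simp [Opt.Allowed, claimOpt]) ?_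
      fun _ => .accept
    have h0 := one_div_regCode_pos R t r
    simp only [claimOpt, Opt.image, Rat.cast_one, one_mul, Bool.false_eq_true, if_false,
      add_zero, zero_sub, abs_neg]
    rw [abs_of_pos h0]
    simpa using hn
  | succ n ih =>
    have small : ∀ (m : ℚ) (v : ℝ), (m : ℝ) * (1 / regCode R t r) = v → m ≤ 1 / 2 →
        v < η * 2 ^ n := fun m v hv hm => by
      have hm : (m : ℝ) ≤ ((1 / 2 : ℚ) : ℝ) := Rat.cast_le.2 hm
      push_cast at hm
      have := mul_le_mul_of_nonneg_right hm (one_div_regCode_pos R t r).le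
      rw [← hv]
      rw [pow_succ] at hn
      linarith
    have half : (1 / regCode R (t + 1) r : ℝ) < η * 2 ^ n := small _ _ (half_mul_regCode R t r) le_rfl
    have p0 := one_div_regCode_pos R
    have p1 := one_div_regCode_le_one R
    have hhalf := half_mul_regCode R t r
    cases hins : ins l with
    | win => exact absurd (.win hins) h
    | lose =>
      refine secondWin_prog_step hη ⟨1 / 2, false, none, fun _ => none⟩
        (by simp [hins, instrOpts]) rfl rfl hhalf (p0 _ _) (p1 _ _) fun _ => .accept
    | incr i a =>
      have hi := hT.lt l hl i (by simp [hins, Instr.Uses])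
      have ha := hT.succs_mem l hl a (by simp [hins, Instr.succs])
      rw [wins_incr_iff hins] at h
      have e := incr_mul_regCode hi t r
      refine secondWin_prog_step hη ⟨1 / oddPrime i, false, none, fun _ => some (.prog a)⟩
        (by simp [hins, instrOpts]) rfl rfl e (p0 _ _) (p1 _ _) fun _ => ih h ha t (small _ _ e ?_)
      have h2 : (2 : ℚ) ≤ oddPrime i := by exact_mod_cast (prime_oddPrime i).two_le
      exact one_div_le_one_div_of_le two_pos h2
    | decz i a b =>
      have hi := hT.lt l hl i (by simp [hins, Instr.Uses])
      have ha := hT.succs_mem l hl a (by simp [hins, Instr.succs])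
      have hb := hT.succs_mem l hl b (by simp [hins, Instr.succs])
      rw [wins_decz_iff hins] at h
      by_cases h0 : r i = 0
      · replace h : ¬ Wins ins a r := fun hw => h ⟨fun _ => hw, fun h' => absurd h0 h'⟩
        refine secondWin_prog_step hη
          ⟨1 / 2, false, none, ![some (.prog a), some (.strip (some i))]⟩
          (by simp [hins, instrOpts]) rfl rfl hhalf (p0 _ _) (p1 _ _) fun c => ?_
        fin_cases c
        · exact ih h ha _ half
        · exact secondWin_strip hη (regCode_mem_stripMonoid R _ (by simpa using h0))
      · replace h : ¬ Wins ins b (update r i (r i - 1)) :=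
          fun hw => h ⟨fun h' => absurd h' h0, fun _ => hw⟩
        have e := decr_mul_regCode hi t h0
        refine secondWin_prog_step hη
          ⟨oddPrime i / 2 ^ oddPrime i, false, none, ![some (.prog b), some (.strip none)]⟩
          (by simp [hins, instrOpts]) rfl rfl e (p0 _ _) (p1 _ _) fun c => ?_
        fin_cases c
        · refine ih h hb _ (small _ _ e ?_)
          rw [div_le_div_iff₀ (by positivity) two_pos, one_mul]
          have : oddPrime i * 2 ≤ 2 ^ oddPrime i := by
            obtain ⟨k, hk⟩ := Nat.exists_eq_succ_of_ne_zero (prime_oddPrime i).ne_zero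
            rw [hk, pow_succ]
            exact Nat.mul_le_mul_right 2 Nat.lt_two_pow_self
          exact_mod_cast this
        · exact secondWin_strip hη (regCode_mem_stripMonoid R _ (by simp))
    | eor a b =>
      have ha := hT.succs_mem l hl a (by simp [hins, Instr.succs])
      have hb := hT.succs_mem l hl b (by simp [hins, Instr.succs])
      rw [wins_eor_iff hins, not_or] at h
      refine secondWin_prog_step hη ⟨1 / 2, false, none, ![some (.prog a), some (.prog b)]⟩
        (by simp [hins, instrOpts]) rfl rfl hhalf (p0 _ _) (p1 _ _) fun c => ?_
      fin_cases c
      · exact ih h.1 ha _ half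
      · exact ih h.2 hb _ half
    | sand a b =>
      have ha := hT.succs_mem l hl a (by simp [hins, Instr.succs])
      have hb := hT.succs_mem l hl b (by simp [hins, Instr.succs])
      rw [wins_sand_iff hins, not_and_or] at h
      rcases h with h | h
      · exact secondWin_prog_step hη ⟨1 / 2, false, none, fun _ => some (.prog a)⟩
          (by simp [hins, instrOpts]) rfl rfl hhalf (p0 _ _) (p1 _ _) fun _ => ih h ha _ half
      · exact secondWin_prog_step hη ⟨1 / 2, false, none, fun _ => some (.prog b)⟩
          (by simp [hins, instrOpts]) rfl rfl hhalf (p0 _ _) (p1 _ _) fun _ => ih h hb _ half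

theorem regCode_input (hR : 0 < R) (n : ℕ) : regCode R 0 (update 0 0 n) = oddPrime 0 ^ n := by
  rw [regCode, pow_zero, one_mul, Finset.prod_eq_single_of_mem 0 (Finset.mem_range.2 hR)]
  · simp
  · intro j _ hj
    simp [hj]

theorem exactWin_init (hT : IsControlSet ins R T) (hR : 0 < R) (hs : start ∈ T) {n : ℕ}
    (h : Wins ins start (update 0 0 n)) :
    ExactWin (simOpts R start ins) (1 / (oddPrime 0 ^ n : ℕ)) .init 0 := by
  refine .of_forall fun o ho _ => ?_
  obtain rfl := List.mem_singleton.1 ho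
  refine ⟨0, _, rfl, ?_⟩
  have := exactWin_prog (β := 1 / (oddPrime 0 ^ n : ℕ)) (start := start) hT h hs 0
  rw [regCode_input hR] at this
  simpa [Opt.image] using this

theorem secondWin_init (hT : IsControlSet ins R T) (hR : 0 < R) (hs : start ∈ T) {n : ℕ}
    (h : ¬ Wins ins start (update 0 0 n)) {η : ℝ} (hη : 0 < η) :
    SecondWin (simOpts R start ins) (1 / (oddPrime 0 ^ n : ℕ)) η (some .init) 0 := by
  obtain ⟨k, hk⟩ := pow_unbounded_of_one_lt (1 / η) (one_lt_two : (1 : ℝ) < 2)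
  rw [div_lt_iff₀' hη] at hk
  have e := regCode_input hR n
  have h1 := one_div_regCode_le_one R 0 (update 0 0 n)
  have h2 := secondWin_prog (β := 1 / (oddPrime 0 ^ n : ℕ)) (start := start) hT hη k h hs 0
    (h1.trans_lt hk)
  have h0 := one_div_regCode_pos R 0 (update 0 0 n)
  rw [e] at h0 h1 h2
  refine .step ⟨0, true, none, fun _ => some (.prog start)⟩ _ (by simp [simOpts])
    ⟨h0.le, h1, by simp⟩ ?_ fun _ => h2
  simpa [Opt.image] using hη

end Sim

end MultiModeGame

namespace MultiModeGame

open StructuredBMS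

/-! ### Criteria for reachability and its failure -/

/-- The environment answers every move by a rate that preserves the invariant. Safety only restricts
the scheduler further, so `S` plays no role. -/
theorem not_reachable_of_invariant {H : StructuredBMS} {S : Set ℝ} {p ε : ℝ} (hH : H.WellFormed)
    (Inv : Config → Prop) (hstart : Inv H.start)
    (hstep : ∀ c m, Inv c → H.Enabled c m → ∃ r ∈ H.rateSet m.edge.dst, Inv (next c m r))
    (htarget : ∀ c, Inv c → c.loc ∈ H.targets → c.val ∉ Metric.ball p ε) :
    ¬ H.Reachable S p ε := by
  classical
  rintro ⟨σ, hσ⟩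
  have hne : ∀ m : Move, m.edge ∈ H.edges → (H.rateSet m.edge.dst).Nonempty := fun m hm => by
    have hlt := (hH.2.1 _ hm).2
    obtain ⟨r, hr⟩ := hH.2.2.2 _ (List.getElem_mem hlt)
    exact ⟨r, _, List.getElem?_eq_getElem hlt, hr⟩
  have hex : ∀ (h : History) (m : Move), ∃ r, m.edge ∈ H.edges → r ∈ H.rateSet m.edge.dst ∧
      (Inv (H.last h) → H.Enabled (H.last h) m → Inv (next (H.last h) m r)) := fun h m => by
    by_cases hm : m.edge ∈ H.edges
    · by_cases hi : Inv (H.last h) ∧ H.Enabled (H.last h) m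
      · obtain ⟨r, hr, hr'⟩ := hstep _ _ hi.1 hi.2
        exact ⟨r, fun _ => ⟨hr, fun _ _ => hr'⟩⟩
      · obtain ⟨r, hr⟩ := hne m hm
        exact ⟨r, fun _ => ⟨hr, fun h1 h2 => absurd ⟨h1, h2⟩ hi⟩⟩
    · exact ⟨0, fun h => absurd h hm⟩
  choose π hπ using hex
  obtain ⟨n, -, hok, ht, hb⟩ := hσ π fun h m hm => (hπ h m hm).1
  refine htarget _ ?_ ht hb
  clear ht hb
  induction n with
  | zero => exact hstart
  | succ n ih =>
    have h1 := ih fun k hk => hok k (hk.trans n.lt_succ_self)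
    have h2 := (hok n n.lt_succ_self).1
    have := (hπ _ _ h2.1).2 h1 h2
    simpa [play, last, List.foldl_append] using this

/-- The scheduler can force a visit to a target location with the variable near `p`, with values of
the variable in `A` after every round. -/
inductive Forces (H : StructuredBMS) (A : Set ℝ) (p ε : ℝ) : Config → Prop where
  | target {c} : c.loc ∈ H.targets → c.val ∈ Metric.ball p ε → Forces H A p ε c
  | move {c} (m : Move) : H.Enabled c m → (∀ r ∈ H.rateSet m.edge.dst, (next c m r).val ∈ A) →
      (∀ r ∈ H.rateSet m.edge.dst, Forces H A p ε (next c m r)) → Forces H A p ε c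

/-- Splitting off the first round instead of the last matches the recursive structure of `Forces`.
-/
theorem play_succ' (σ : Scheduler) (π : Environment) (n : ℕ) :
    play σ π (n + 1) = (σ [], π [] (σ [])) ::
      play (fun h => σ ((σ [], π [] (σ [])) :: h)) (fun h => π ((σ [], π [] (σ [])) :: h)) n := by
  induction n with
  | zero => rfl
  | succ n ih =>
    rw [play, ih]
    simp only [play, List.cons_append]

theorem add_mul_mem_of_convex {A : Set ℝ} (hA : Convex ℝ A) {v t r s : ℝ} (h0 : v ∈ A)
    (h1 : v + t * r ∈ A) (hs : s ∈ Set.Icc 0 t) : v + s * r ∈ A := by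
  rcases hs.1.eq_or_lt with rfl | hs0
  · simpa using h0
  have ht : 0 < t := hs0.trans_le hs.2
  have := hA.add_smul_sub_mem h0 h1 (t := s / t)
    ⟨by positivity, (div_le_one ht).2 hs.2⟩
  convert this using 1
  simp only [smul_eq_mul]
  field_simp
  ring

/-- The first rate in the history tells which of the strategies for the subtrees to follow. Values
between the ends of a round are safe by convexity of `A`. -/
theorem Forces.exists_scheduler {H : StructuredBMS} {S A : Set ℝ} {p ε : ℝ} (hA : Convex ℝ A)
    (hAS : A ⊆ S) {c : Config} (h : Forces H A p ε c) (hc : c.val ∈ A) :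
    ∃ σ : Scheduler, ∀ π : Environment, π.Legal H → ∃ n,
      (∀ k < n, H.Enabled ((play σ π k).foldl (fun c s => next c s.1 s.2) c) (σ (play σ π k)) ∧
        ∀ s ∈ Set.Icc 0 (σ (play σ π k)).time,
          ((play σ π k).foldl (fun c s => next c s.1 s.2) c).val +
            s * π (play σ π k) (σ (play σ π k)) ∈ S) ∧
      ((play σ π n).foldl (fun c s => next c s.1 s.2) c).loc ∈ H.targets ∧
      ((play σ π n).foldl (fun c s => next c s.1 s.2) c).val ∈ Metric.ball p ε := by
  classical
  induction h with
  | target h1 h2 => exact ⟨fun _ => ⟨⟨0, [], [], 0⟩, 0⟩, fun π _ => ⟨0, by simp, h1, h2⟩⟩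
  | @move c m hm hval _ ih =>
    choose τ hτ using fun r (hr : r ∈ H.rateSet m.edge.dst) => ih r hr (hval r hr)
    let σ : Scheduler := fun h => match h with
      | [] => m
      | s :: h => if hr : s.2 ∈ H.rateSet m.edge.dst then τ s.2 hr h else m
    refine ⟨σ, fun π hπ => ?_⟩
    have hr : π [] m ∈ H.rateSet m.edge.dst := hπ [] m hm.1
    have hσ : (fun h => σ ((σ [], π [] (σ [])) :: h)) = τ (π [] m) hr := by
      funext h
      exact dif_pos hr
    obtain ⟨n, hok, ht, hb⟩ := hτ (π [] m) hr (fun h => π ((m, π [] m) :: h))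
      fun h m' hm' => hπ _ m' hm'
    have hplay : ∀ k, play σ π (k + 1) = (m, π [] m) ::
        play (τ (π [] m) hr) (fun h => π ((m, π [] m) :: h)) k := fun k => by
      rw [play_succ', hσ]
    have hσ' : ∀ h, σ ((m, π [] m) :: h) = τ (π [] m) hr h := fun h => congrFun hσ h
    refine ⟨n + 1, fun k hk => ?_, ?_, ?_⟩
    · cases k with
      | zero => exact ⟨hm, fun s hs => hAS (add_mul_mem_of_convex hA hc (hval _ hr) hs)⟩
      | succ k =>
        rw [hplay, hσ']
        exact hok k (by omega)
    · rw [hplay]; exact ht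
    · rw [hplay]; exact hb

theorem Forces.reachable {H : StructuredBMS} {S A : Set ℝ} {p ε : ℝ} (hA : Convex ℝ A)
    (hAS : A ⊆ S) (h : Forces H A p ε H.start) (hc : H.start.val ∈ A) : H.Reachable S p ε := by
  obtain ⟨σ, hσ⟩ := h.exists_scheduler hA hAS hc
  refine ⟨σ, fun π hπ => ?_⟩
  obtain ⟨n, hok, ht, hb⟩ := hσ π hπ
  exact ⟨n, hAS hc, hok, ht, hb⟩

end MultiModeGame

namespace MultiModeGame

open StructuredBMS

/-! ### The multi-mode system that simulates a game on a real number

Between rounds one clock is zero and the other one, the hot clock, has value `1 + u`. -/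

/-- The locations, for a game with `N` options. In `guess i h` the hot clock is `h` and the scheduler
waits for `1 + u'` time units, while the environment announces by its rate which of the two
successors of option `i` it chooses, or that it objects to `u'` being too large or too small. -/
inductive Loc (N : ℕ) : Type where
  | accept
  | init
  | wait
  | guess (i : Fin N) (h : Fin 2)
  | hold (i : Fin N) (h a : Fin 2)
  | undo (i : Fin N) (h a : Fin 2)
  | check (s : Fin 4) (i : Fin N) (h a : Fin 2)

instance (N : ℕ) : Finite (Loc N) := by
  let f : Loc N → Option (Option (Option ((Fin N × Fin 2) ⊕ (Fin N × Fin 2 × Fin 2) ⊕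
      (Fin N × Fin 2 × Fin 2) ⊕ (Fin 4 × Fin N × Fin 2 × Fin 2)))) := fun
    | .accept => none
    | .init => some none
    | .wait => some (some none)
    | .guess i h => some (some (some (.inl (i, h))))
    | .hold i h a => some (some (some (.inr (.inl (i, h, a)))))
    | .undo i h a => some (some (some (.inr (.inr (.inl (i, h, a))))))
    | .check s i h a => some (some (some (.inr (.inr (.inr (s, i, h, a))))))
  refine Finite.of_injective f fun x y hxy => ?_
  cases x <;> cases y <;> simp_all [f]

noncomputable instance (N : ℕ) : Fintype (Loc N) := Fintype.ofFinite _

/-- The number of a location. -/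
noncomputable def Loc.num {N : ℕ} (l : Loc N) : ℕ := Fintype.equivFin (Loc N) l

theorem Loc.num_injective {N : ℕ} : Function.Injective (Loc.num (N := N)) := fun _ _ h =>
  (Fintype.equivFin _).injective (Fin.ext h)

/-- A fraction that denotes a given rational number. -/
def ratCode (q : ℚ) : RatCode := (q.num, q.den - 1)

theorem value_ratCode (q : ℚ) : (ratCode q).value = q := by
  have h : ((q.den - 1 : ℕ) : ℝ) + 1 = q.den := by
    exact_mod_cast Nat.sub_add_cancel q.den_pos
  rw [RatCode.value, ratCode, h]
  exact_mod_cast q.num_div_den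

theorem value_int (k : ℤ) : RatCode.value (k, 0) = k := by simp [RatCode.value]

/-- The sign of an objection. -/
def objSign (a : Fin 2) : ℤ := if a = 0 then 1 else -1

section System

variable {Q : Type} (os : List (Q × Opt Q)) (q₀ : Q) (J : ℕ) (R₀ : RateSet) (β z₀ : RatCode)

/-- The rates in the first three stages of checking an objection. -/
def checkRate (o : Opt Q) (a : Fin 2) : Fin 3 → ℚ
  | 0 => (a + 2 : ℕ) * J + objSign a
  | 1 => (a + 2 : ℕ) * J + objSign a + objSign a * o.mult
  | 2 => -5 * ((a + 2 : ℕ) * J + objSign a) - objSign a * (o.mult - 1)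

/-- The rate in the last stage of checking an objection. -/
def inputRate (o : Opt Q) (a : Fin 2) : RatCode :=
  if o.inp then (objSign a * β.1, β.2) else (0, 0)

/-- The rates of the locations. -/
def locRate : Loc os.length → RateSet
  | .wait => R₀
  | .guess _ _ => .finite [(0, 0), (J, 0), (2 * J, 0), (3 * J, 0)]
  | .undo _ _ a => .finite [(-(a.val * J : ℕ), 0)]
  | .check 0 i _ a => .finite [ratCode (checkRate J os[i].2 a 0)]
  | .check 1 i _ a => .finite [ratCode (checkRate J os[i].2 a 1)]
  | .check 2 i _ a => .finite [ratCode (checkRate J os[i].2 a 2)]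
  | .check 3 i _ a => .finite [inputRate β os[i].2 a]
  | _ => .finite [(0, 0)]

/-- The guard of a completed guess, on the clock `c`. -/
def guessGuard (o : Opt Q) (c : Fin 2) : List ClockConstraint :=
  ⟨c, .ge, 1⟩ :: ⟨c, .le, 2⟩ :: o.fix.toList.map fun k : Fin 2 => ⟨c, .eq, k.val + 1⟩

open Classical in
/-- The indices of the options in a control state. -/
noncomputable def optsAt (q : Q) : List (Fin os.length) :=
  (List.finRange os.length).filter fun i => os[i].1 = q

/-- The transitions that leave a location: guard, reset, and location that is entered. -/
noncomputable def locEdges : Loc os.length → List (List ClockConstraint × List (Fin 2) × Loc os.length)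
  | .accept => []
  | .init => [([], [], .wait)]
  | .wait => (optsAt os q₀).map fun i => ([⟨0, .eq, 1⟩], [0], .guess i 1)
  -- The transition taken declares the announced rate: `hold` for the multiple `a` of `J`, `check`
  -- for the multiple `a + 2`. The guards cannot detect a false declaration; the variable records
  -- it.
  | .guess i h =>
    (List.finRange 2).map (fun a => (guessGuard os[i].2 (h + 1), [h], .hold i h a)) ++
      (List.finRange 2).map fun a => (guessGuard os[i].2 (h + 1), [], .check 0 i h a)
  -- Clock `h` restarts on entering `hold`. After waiting until the other clock is `3`, clock `h`
  -- needs exactly the duration of the guess to reach `3` itself, so `undo` lasts just that long and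
  -- the other clock ends with the stored value.
  | .hold i h a => [([⟨h + 1, .eq, 3⟩], [h + 1], .undo i h a)]
  | .undo i h a => match os[i].2.next a with
    | none => [([⟨h, .eq, 3⟩], [h], .accept)]
    | some q => (optsAt os q).map fun j => ([⟨h, .eq, 3⟩], [h], .guess j (h + 1))
  | .check 0 i h a => [([⟨h, .eq, 5⟩], [], .check 1 i h a)]
  | .check 1 i h a => [([⟨h + 1, .eq, 5⟩], [h + 1], .check 2 i h a)]
  | .check 2 i h a => [([⟨h + 1, .eq, 1⟩], [h + 1], .check 3 i h a)]
  | .check 3 _ h _ => [([⟨h + 1, .eq, 1⟩], [], .accept)]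

/-- The transitions, with numbered locations. -/
noncomputable def allEdges : List Edge :=
  (Finset.univ : Finset (Loc os.length)).toList.flatMap fun l =>
    (locEdges os q₀ l).map fun x => ⟨l.num, x.1, x.2.1, x.2.2.num⟩

/-- The system that simulates the game. -/
noncomputable def system : StructuredBMS where
  rates := List.ofFn fun k => locRate os J R₀ β ((Fintype.equivFin (Loc os.length)).symm k)
  edges := allEdges os q₀
  initLoc := Loc.num (.init : Loc os.length)
  initVal := z₀
  targets := [Loc.num (.accept : Loc os.length)]

variable {os q₀ J R₀ β z₀}

theorem mem_optsAt {q : Q} {i : Fin os.length} : i ∈ optsAt os q ↔ os[i].1 = q := by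
  simp [optsAt]

theorem mem_edges {e : Edge} : e ∈ (system os q₀ J R₀ β z₀).edges ↔
    ∃ l, ∃ x ∈ locEdges os q₀ l, e = ⟨l.num, x.1, x.2.1, x.2.2.num⟩ := by
  simp [system, allEdges, eq_comm]

theorem rates_getElem? (l : Loc os.length) :
    (system os q₀ J R₀ β z₀).rates[l.num]? = some (locRate os J R₀ β l) := by
  simp [system, Loc.num]

theorem rateSet_num (l : Loc os.length) :
    (system os q₀ J R₀ β z₀).rateSet l.num = (locRate os J R₀ β l).toSet := by
  ext r
  simp [rateSet, rates_getElem?]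

theorem num_lt (l : Loc os.length) : l.num < (system os q₀ J R₀ β z₀).rates.length := by
  simp [system, Loc.num]

theorem wellFormed_system (hR : R₀.toSet.Nonempty) : (system os q₀ J R₀ β z₀).WellFormed := by
  refine ⟨num_lt _, fun e he => ?_, fun l hl => ?_, fun R hR' => ?_⟩
  · obtain ⟨l, x, -, rfl⟩ := mem_edges.1 he
    exact ⟨num_lt _, num_lt _⟩
  · obtain rfl := List.mem_singleton.1 hl
    exact num_lt _
  · obtain ⟨k, rfl⟩ := (List.mem_ofFn' _ _).1 hR'
    change (locRate os J R₀ β _).toSet.Nonempty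
    generalize (Fintype.equivFin (Loc os.length)).symm k = l
    have hfin : ∀ q qs, (RateSet.finite (q :: qs)).toSet.Nonempty := fun q qs =>
      ⟨q.value, q, List.mem_cons_self, rfl⟩
    cases l with
    | wait => exact hR
    | check s i h a => fin_cases s <;> exact hfin _ _
    | _ => exact hfin _ _

theorem fin2_succ_ne (h : Fin 2) : h + 1 ≠ h := by revert h; decide

theorem fin2_succ_succ (h : Fin 2) : h + 1 + 1 = h := by revert h; decide

theorem sat_guessGuard {o : Opt Q} {c : Fin 2} {ν : Fin 2 → ℝ} :
    (∀ g ∈ guessGuard o c, g.Sat ν) ↔ o.Allowed (ν c - 1) := by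
  rw [guessGuard, List.forall_mem_cons, List.forall_mem_cons, List.forall_mem_map]
  simp only [Option.mem_toList, ClockConstraint.Sat, Cmp.holds, Opt.Allowed, Nat.cast_one,
    Nat.cast_ofNat, Nat.cast_add]
  refine and_congr ?_ (and_congr ?_ (forall_congr' fun k => imp_congr_right fun _ => ?_))
  · constructor <;> intro h <;> linarith
  · constructor <;> intro h <;> linarith
  · constructor <;> intro h <;> linarith

end System

end MultiModeGame

/-! ### Soundness: a robust win of the first player gives an environment strategy -/

namespace MultiModeGame

open StructuredBMS

section Soundness

variable {Q : Type} {os : List (Q × Opt Q)} {q₀ : Q} {J : ℕ} {R₀ : RateSet} {β z₀ : RatCode}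

/-- The variable is off by at least `J`, or it is not off and the first player wins from the chosen
successor. -/
def OffOrWin (opts : Q → List (Opt Q)) (J : ℕ) (β : RatCode) (η o : ℝ) (n : Option Q) (u : ℝ) :
    Prop :=
  (J : ℝ) ≤ |o| ∨ (o = 0 ∧ ∃ q, n = some q ∧ RobustWin opts β.value η q u)

/-- The announcement `k` of the environment is winning for it. -/
def GoodSignal (opts : Q → List (Opt Q)) (β : RatCode) (η : ℝ) (o : Opt Q) (u u' : ℝ)
    (k : Fin 4) : Prop :=
  (∀ a : Fin 2, k.val = a.val → ∃ q, o.next a = some q ∧ RobustWin opts β.value η q u') ∧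
    ∀ a : Fin 2, k.val = a.val + 2 → η ≤ objSign a * (u' - o.image β.value u)

/-- The invariant with which the environment prevents the variable from being in `G` in a target
location. Here `b` is the undisturbed value of the variable and `w` the initial rate. -/
def EnvInv (opts : Q → List (Opt Q)) (os : List (Q × Opt Q)) (J : ℕ) (β z₀ : RatCode)
    (η w b : ℝ) (G : Set ℝ) : Loc os.length → (Fin 2 → ℝ) → ℝ → Prop
  | .accept, _, z => z ∉ G
  | .init, ν, z => ν 0 = 0 ∧ ν 1 = 0 ∧ z = z₀.value
  | .wait, ν, z => ν 0 = ν 1 ∧ z = z₀.value + ν 0 * w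
  | .guess i h, ν, z => ∃ d, 1 ≤ d ∧ d ≤ 2 ∧ ν h = ν (h + 1) + d ∧
      ∃ (o : ℝ) (k : Fin 4), z = b + o + k.val * J * ν (h + 1) ∧
        (J ≤ o ∧ k = 3 ∨ o ≤ -J ∧ k = 0 ∨ o = 0 ∧ (os[i].2.Allowed (ν (h + 1) - 1) →
          GoodSignal opts β η os[i].2 (d - 1) (ν (h + 1) - 1) k))
  | .hold i h a, ν, z => ∃ d, 1 ≤ d ∧ d ≤ 2 ∧ ν (h + 1) = ν h + d ∧
      ∃ o, z = b + o + a.val * J * d ∧ OffOrWin opts J β η o (os[i].2.next a) (d - 1)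
  | .undo i h a, ν, z => ∃ d, 1 ≤ d ∧ d ≤ 2 ∧ ν h = 3 - d + ν (h + 1) ∧
      ∃ o, z = b + o + a.val * J * (d - ν (h + 1)) ∧
        OffOrWin opts J β η o (os[i].2.next a) (d - 1)
  | .check 0 i h a, ν, z => ∃ d, ν h = ν (h + 1) + d ∧
      z + checkRate J os[i].2 a 0 * (5 - ν h) + checkRate J os[i].2 a 1 * d +
        checkRate J os[i].2 a 2 + (inputRate β os[i].2 a).value ∉ G
  | .check 1 i h a, ν, z => z + checkRate J os[i].2 a 1 * (5 - ν (h + 1)) +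
        checkRate J os[i].2 a 2 + (inputRate β os[i].2 a).value ∉ G
  | .check 2 i h a, ν, z => z + checkRate J os[i].2 a 2 * (1 - ν (h + 1)) +
        (inputRate β os[i].2 a).value ∉ G
  | .check 3 i h a, ν, z => z + (inputRate β os[i].2 a).value * (1 - ν (h + 1)) ∉ G

/-- The effect of a move on the clocks. -/
def moveClock (ν : Fin 2 → ℝ) (reset : List (Fin 2)) (t : ℝ) : Fin 2 → ℝ :=
  fun i => (if i ∈ reset then 0 else ν i) + t

theorem mem_toSet_singleton (q : RatCode) : q.value ∈ (RateSet.finite [q]).toSet :=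
  ⟨q, List.mem_cons_self, rfl⟩

theorem value_inputRate (o : Opt Q) (a : Fin 2) :
    (inputRate β o a).value = objSign a * if o.inp then β.value else 0 := by
  unfold inputRate
  split <;> simp [RatCode.value, mul_div_assoc]

/-- Let `c` be the rate of stage 0. Stages 0 and 1 last `5 - (d' + d)` and `d`, so together with the
`-5 * c` of stage 2 the common rate contributes `-c * d'`. The extra rate in stage 1 supplies the
multiple of `d`, and the last stage the input. What remains is the declared multiple of `J * d'`
with negative sign, and the signed error. -/
theorem check_value (o : Opt Q) (a : Fin 2) (k d d' z : ℝ) :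
    z + k * J * d' + checkRate J o a 0 * (5 - (d' + d)) + checkRate J o a 1 * d +
      checkRate J o a 2 + (inputRate β o a).value =
    z + (k - (a.val + 2)) * (J * d') -
      objSign a * ((d' - 1) - o.image β.value (d - 1)) := by
  rw [value_inputRate]
  simp only [checkRate, Opt.image]
  push_cast
  ring

theorem abs_objSign (a : Fin 2) : |(objSign a : ℝ)| = 1 := by
  fin_cases a <;> simp [objSign]

variable {opts : Q → List (Opt Q)} {η w b δ : ℝ}

/-- The assumptions under which the environment succeeds. -/
structure EnvHyp (opts : Q → List (Opt Q)) (os : List (Q × Opt Q)) (q₀ : Q) (J : ℕ)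
    (R₀ : RateSet) (β z₀ : RatCode) (η w b δ : ℝ) : Prop where
  mem_opts : ∀ x ∈ os, x.2 ∈ opts x.1
  mult_le : ∀ x ∈ os, |(x.2.mult : ℝ)| + 10 ≤ J
  input_nonneg : 0 ≤ β.value
  input_le : β.value ≤ 1
  rate_mem : w ∈ R₀.toSet
  base : b = z₀.value + w
  abs_base_le : |b - 7| ≤ 1
  radius_le : δ ≤ 1
  lt_of_mem_ball : ∀ g, b - g ∈ Metric.ball 7 δ → g < η
  win : RobustWin opts β.value η q₀ 0

theorem EnvHyp.abs_error_le (H : EnvHyp opts os q₀ J R₀ β z₀ η w b δ) {x : Q × Opt Q}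
    (hx : x ∈ os) {u u' : ℝ} (h0 : 0 ≤ u) (h1 : u ≤ 1) (h0' : 0 ≤ u') (h1' : u' ≤ 1) :
    |u' - x.2.image β.value u| ≤ J - 8 := by
  have hm := H.mult_le x hx
  have e1 : |(x.2.mult : ℝ) * u| ≤ |(x.2.mult : ℝ)| := by
    rw [abs_mul, abs_of_nonneg h0]
    exact mul_le_of_le_one_right (abs_nonneg _) h1
  have e2 : |if x.2.inp then β.value else 0| ≤ 1 := by
    split
    · rw [abs_of_nonneg H.input_nonneg]; exact H.input_le
    · simp
  rw [abs_le] at e1 e2 ⊢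
  simp only [Opt.image]
  constructor <;> linarith [e1.1, e1.2, e2.1, e2.2]

/-- The base value and the radius account for at most `1` each, and an arithmetic error for at most
`J - 8`; together they cannot make up for an offset of `J`. -/
theorem EnvHyp.not_mem_ball_of_off (H : EnvHyp opts os q₀ J R₀ β z₀ η w b δ) {o g : ℝ}
    (ho : (J : ℝ) ≤ |o|) (hg : |g| ≤ J - 8) : b + o - g ∉ Metric.ball 7 δ := by
  rw [Metric.mem_ball, Real.dist_eq, not_lt]
  have h1 := H.abs_base_le
  have h2 := H.radius_le
  have e : o = (b + o - g - 7) - (b - 7) + g := by ring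
  have h3 : |o| ≤ |b + o - g - 7| + |b - 7| + |g| := by
    nth_rewrite 1 [e]
    exact (abs_add_le _ _).trans (add_le_add_left (abs_sub _ _) _)
  linarith

theorem mul_mem_guess_rates (i : Fin os.length) (h : Fin 2) (k : Fin 4) :
    (k.val * J : ℝ) ∈ (locRate os J R₀ β (.guess i h)).toSet := by
  refine ⟨((k.val * J : ℤ), 0), ?_, by rw [value_int]; push_cast; rfl⟩
  fin_cases k <;> simp

/-- Once the variable is off, the environment announces the extreme multiple in the direction of the
offset, so no declaration `m` brings it back. If it is not off, a false declaration moves it by at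
least `J * d`. -/
theorem le_abs_offset {J : ℕ} {o d : ℝ} {k : Fin 4} {m : ℕ} (hm : m ≤ 3) (hd : 1 ≤ d)
    (h : J ≤ o ∧ k = 3 ∨ o ≤ -J ∧ k = 0 ∨ o = 0) :
    (J : ℝ) ≤ |o + (k.val - m) * (J * d)| ∨ (o = 0 ∧ k.val = m) := by
  have hJ : (0 : ℝ) ≤ J := Nat.cast_nonneg J
  have hJd : (J : ℝ) ≤ J * d := le_mul_of_one_le_right hJ hd
  have hm' : (m : ℝ) ≤ 3 := by exact_mod_cast hm
  have hm0 : (0 : ℝ) ≤ m := Nat.cast_nonneg m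
  rcases h with ⟨ho, rfl⟩ | ⟨ho, rfl⟩ | rfl
  · left
    refine le_trans ?_ (le_abs_self _)
    have : (0 : ℝ) ≤ (3 - m) * (J * d) := mul_nonneg (by linarith) (by linarith)
    change (J : ℝ) ≤ o + (((3 : ℕ) : ℝ) - m) * (J * d)
    push_cast
    linarith
  · left
    refine le_trans ?_ (neg_le_abs _)
    have : (0 : ℝ) ≤ m * (J * d) := mul_nonneg hm0 (by linarith)
    change (J : ℝ) ≤ -(o + (((0 : ℕ) : ℝ) - m) * (J * d))
    push_cast
    linarith
  · by_cases hk : k.val = m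
    · exact .inr ⟨rfl, hk⟩
    · left
      have h1 : (1 : ℝ) ≤ |(k.val : ℝ) - m| := by
        have : (1 : ℤ) ≤ |(k.val : ℤ) - m| := Int.one_le_abs (by omega)
        exact_mod_cast this
      rw [zero_add, abs_mul, abs_of_nonneg (hJ.trans hJd)]
      nlinarith

/-- The only real decision is the announcement in `guess`; the first rate is fixed as `w`, and all
other locations have a single rate. During a check the invariant says that the predicted final value
misses the target. -/
theorem EnvHyp.step (H : EnvHyp opts os q₀ J R₀ β z₀ η w b δ) {l : Loc os.length}
    {ν : Fin 2 → ℝ} {z t : ℝ}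
    (hI : EnvInv opts os J β z₀ η w b (Metric.ball 7 δ) l ν z)
    {x : List ClockConstraint × List (Fin 2) × Loc os.length} (hx : x ∈ locEdges os q₀ l)
    (hg : ∀ g ∈ x.1, g.Sat ν) :
    ∃ r ∈ (locRate os J R₀ β x.2.2).toSet,
      EnvInv opts os J β z₀ η w b (Metric.ball 7 δ) x.2.2 (moveClock ν x.2.1 t) (z + t * r) := by
  have hne := fin2_succ_ne
  -- The scheduler commits to the duration before the rate is chosen, so the announcement may depend
  -- on the new number `t - 1`.
  have guessStep : ∀ (q : Q) (i : Fin os.length) (h : Fin 2) (ν : Fin 2 → ℝ) (o : ℝ)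
      (reset : List (Fin 2)), os[i].1 = q → h ∉ reset → h + 1 ∈ reset → 1 ≤ ν h → ν h ≤ 2 →
      OffOrWin opts J β η o (some q) (ν h - 1) →
      ∃ r ∈ (locRate os J R₀ β (.guess i h)).toSet,
        EnvInv opts os J β z₀ η w b (Metric.ball 7 δ) (.guess i h) (moveClock ν reset t)
          (b + o + t * r) := by
    intro q i h ν o reset hi h1 h2 hd1 hd2 ho
    have hc : moveClock ν reset t (h + 1) = t := by simp [moveClock, h2]
    have hh : moveClock ν reset t h = ν h + t := by simp [moveClock, h1]
    suffices ∃ k : Fin 4, (J ≤ o ∧ k = 3 ∨ o ≤ -J ∧ k = 0 ∨ o = 0 ∧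
        (os[i].2.Allowed (t - 1) → GoodSignal opts β η os[i].2 (ν h - 1) (t - 1) k)) by
      obtain ⟨k, hk⟩ := this
      refine ⟨_, mul_mem_guess_rates i h k, ν h, hd1, hd2, ?_, o, k, ?_, ?_⟩
      · rw [hc, hh, add_comm]
      · rw [hc]; ring
      · rw [hc]; exact hk
    rcases ho with ho | ⟨rfl, q', hq', hw⟩
    · rcases le_abs'.1 ho with ho | ho
      · exact ⟨0, .inr (.inl ⟨ho, rfl⟩)⟩
      · exact ⟨3, .inl ⟨ho, rfl⟩⟩
    obtain rfl := Option.some.inj hq'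
    -- With a forbidden number the guards block every exit, so any announcement will do. Otherwise
    -- the environment objects to an error of at least `η` with the matching sign, and else follows
    -- the robust strategy.
    by_cases ha : os[i].2.Allowed (t - 1)
    swap
    · exact ⟨0, .inr (.inr ⟨rfl, fun h => absurd h ha⟩)⟩
    set e := (t - 1) - os[i].2.image β.value (ν h - 1) with he
    by_cases h1 : η ≤ e
    · refine ⟨2, .inr (.inr ⟨rfl, fun _ => ⟨fun a h => ?_, fun a h => ?_⟩⟩)⟩
      · exact absurd h (by fin_cases a <;> decide)
      · have : a = 0 := by revert h; revert a; decide
        subst this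
        simp only [objSign, ← he]
        norm_num
        exact h1
    by_cases h2 : η ≤ -e
    · refine ⟨3, .inr (.inr ⟨rfl, fun _ => ⟨fun a h => ?_, fun a h => ?_⟩⟩)⟩
      · exact absurd h (by fin_cases a <;> decide)
      · have : a = 1 := by revert h; revert a; decide
        subst this
        simp only [objSign, ← he]
        norm_num
        linarith
    have hlt : |e| < η := by rw [abs_lt]; constructor <;> linarith
    have hmem : os[i].2 ∈ opts q := by
      have := H.mem_opts os[i] (List.getElem_mem _)
      rwa [hi] at this
    obtain ⟨a, q', hq', hw'⟩ := hw.exists_next hmem ha hlt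
    refine ⟨⟨a.val, by omega⟩, .inr (.inr ⟨rfl, fun _ => ⟨fun a' h => ?_, fun a' h => ?_⟩⟩)⟩
    · obtain rfl : a = a' := Fin.ext h
      exact ⟨q', hq', hw'⟩
    · simp only at h
      omega
  cases l with
  | accept => simp [locEdges] at hx
  | init =>
    obtain rfl := List.mem_singleton.1 hx
    obtain ⟨h0, h1, hz⟩ := hI
    exact ⟨w, H.rate_mem, by simp [EnvInv, moveClock, h0, h1, hz]⟩
  | wait =>
    obtain ⟨i, hi, rfl⟩ := List.mem_map.1 hx
    obtain ⟨h0, hz⟩ := hI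
    have hg : ν 0 = 1 := by simpa [ClockConstraint.Sat, Cmp.holds] using hg
    have := guessStep q₀ i 1 ν 0 [0] (mem_optsAt.1 hi) (by simp) (by simp) (by linarith)
      (by linarith) (.inr ⟨rfl, q₀, rfl, by rw [← h0, hg, sub_self]; exact H.win⟩)
    rw [hz, hg, one_mul, ← H.base]
    simpa using this
  | guess i h =>
    obtain ⟨d, hd1, hd2, hd, o, k, hz, hk⟩ := hI
    have hk' : J ≤ o ∧ k = 3 ∨ o ≤ -J ∧ k = 0 ∨ o = 0 := hk.imp_right (Or.imp_right And.left)
    rcases List.mem_append.1 hx with hx | hx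
    · obtain ⟨a, -, rfl⟩ := List.mem_map.1 hx
      have ha := sat_guessGuard.1 hg
      have ha0 := ha.1
      have ha1 := ha.2.1
      refine ⟨_, mem_toSet_singleton _, ν (h + 1), by linarith, by linarith, ?_,
        o + (k.val - a.val) * (J * ν (h + 1)), ?_, ?_⟩
      · simp [moveClock, hne h]
        ring_nf
      · rw [← Int.cast_zero, value_int, hz]
        push_cast
        ring
      · rcases le_abs_offset (m := a.val) (d := ν (h + 1)) (by omega) (by linarith) hk' with h1 | ⟨h1, h2⟩
        · exact .inl h1
        · refine .inr ⟨by rw [h1, h2]; ring, ?_⟩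
          have hJ := H.mult_le os[i] (List.getElem_mem _)
          have := abs_nonneg (os[i].2.mult : ℝ)
          rcases hk with ⟨h3, -⟩ | ⟨h3, -⟩ | ⟨-, h3⟩
          · linarith
          · linarith
          · exact (h3 ha).1 a h2
    · obtain ⟨a, -, rfl⟩ := List.mem_map.1 hx
      have ha := sat_guessGuard.1 hg
      have ha0 := ha.1
      have ha1 := ha.2.1
      refine ⟨_, mem_toSet_singleton _, d, ?_, ?_⟩
      · simp [moveClock, hd]
        ring_nf
      · have e := check_value (J := J) (β := β) os[i].2 a k.val d (ν (h + 1)) (b + o)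
        have e1 : moveClock ν [] t h = ν (h + 1) + d + t := by simp [moveClock, hd]
        rw [value_ratCode, e1, hz]
        have herr := H.abs_error_le (x := os[i]) (List.getElem_mem _) (u := d - 1)
          (by linarith) (by linarith) ha0 ha1
        set err := (ν (h + 1) - 1) - os[i].2.image β.value (d - 1) with herr_def
        have e2 : |(objSign a : ℝ) * err| ≤ J - 8 := by rw [abs_mul, abs_objSign, one_mul]; exact herr
        have e3 : ∀ v, v = b + o + (k.val - (a.val + 2)) * (J * ν (h + 1)) - objSign a * err →
            v ∉ Metric.ball 7 δ := by
          rintro v rfl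
          rcases le_abs_offset (m := a.val + 2) (d := ν (h + 1)) (by omega) (by linarith) hk' with h1 | ⟨h1, h2⟩
          · push_cast at h1
            have := H.not_mem_ball_of_off h1 e2
            rwa [← add_assoc] at this
          · intro hb
            have hJ := H.mult_le os[i] (List.getElem_mem _)
            have := abs_nonneg (os[i].2.mult : ℝ)
            rcases hk with ⟨h3, -⟩ | ⟨h3, -⟩ | ⟨-, h3⟩
            · linarith
            · linarith
            · have h4 := (h3 ha).2 a h2
              refine absurd (H.lt_of_mem_ball (objSign a * err) ?_) (not_lt.2 h4)
              convert hb using 1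
              rw [h1, h2]; push_cast; ring
        refine e3 _ ?_
        rw [← e]
        ring
  | hold i h a =>
    obtain rfl := List.mem_singleton.1 hx
    obtain ⟨d, hd1, hd2, hd, o, hz, ho⟩ := hI
    have hg : ν (h + 1) = 3 := by simpa [ClockConstraint.Sat, Cmp.holds] using hg
    refine ⟨_, mem_toSet_singleton _, d, hd1, hd2, ?_, o, ?_, ho⟩
    · simp [moveClock, (hne h).symm]
      linarith
    · rw [value_int, hz]
      simp [moveClock]
      ring_nf
  | undo i h a =>
    obtain ⟨d, hd1, hd2, hd, o, hz, ho⟩ := hI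
    simp only [locEdges] at hx
    cases hn : os[i].2.next a with
    | none =>
      rw [hn] at hx ho
      obtain rfl := List.mem_singleton.1 hx
      have hg : ν h = 3 := by simpa [ClockConstraint.Sat, Cmp.holds] using hg
      refine ⟨_, mem_toSet_singleton _, ?_⟩
      have hz : z = b + o := by rw [hz, show d - ν (h + 1) = 0 by linarith]; ring
      rcases ho with ho | ⟨-, q, hq, -⟩
      · have hJ := H.mult_le os[i] (List.getElem_mem _)
        have := abs_nonneg (os[i].2.mult : ℝ)
        have := H.not_mem_ball_of_off (g := 0) ho (by rw [abs_zero]; linarith)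
        rw [← Int.cast_zero, value_int, hz]
        simpa [EnvInv] using this
      · exact absurd hq (by simp)
    | some q =>
      rw [hn] at hx ho
      obtain ⟨j, hj, rfl⟩ := List.mem_map.1 hx
      have hg : ν h = 3 := by simpa [ClockConstraint.Sat, Cmp.holds] using hg
      have hz : z = b + o := by rw [hz, show d - ν (h + 1) = 0 by linarith]; ring
      have hd' : ν (h + 1) = d := by linarith
      rw [hz]
      exact guessStep q j (h + 1) ν o [h] (mem_optsAt.1 hj) (by simp [hne h])
        (by simp [fin2_succ_succ]) (by linarith) (by linarith) (by rw [hd']; exact ho)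
  | check s i h a =>
    obtain rfl | rfl | rfl | rfl : s = 0 ∨ s = 1 ∨ s = 2 ∨ s = 3 := by fin_cases s <;> simp
    · obtain rfl := List.mem_singleton.1 hx
      have hg : ν h = 5 := by simpa [ClockConstraint.Sat, Cmp.holds] using hg
      obtain ⟨d, hd, hz⟩ := hI
      refine ⟨_, mem_toSet_singleton _, ?_⟩
      rw [value_ratCode]
      have e : moveClock ν [] t (h + 1) = 5 - d + t := by simp [moveClock]; linarith
      simp only [EnvInv, e]
      convert hz using 1
      rw [hg]; ring_nf
    · obtain rfl := List.mem_singleton.1 hx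
      have hg : ν (h + 1) = 5 := by simpa [ClockConstraint.Sat, Cmp.holds] using hg
      refine ⟨_, mem_toSet_singleton _, ?_⟩
      rw [value_ratCode]
      have e : moveClock ν [h + 1] t (h + 1) = t := by simp [moveClock]
      simp only [EnvInv, e] at hI ⊢
      convert hI using 1
      rw [hg]; ring_nf
    · obtain rfl := List.mem_singleton.1 hx
      have hg : ν (h + 1) = 1 := by simpa [ClockConstraint.Sat, Cmp.holds] using hg
      refine ⟨_, mem_toSet_singleton _, ?_⟩
      have e : moveClock ν [h + 1] t (h + 1) = t := by simp [moveClock]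
      simp only [EnvInv, e] at hI ⊢
      convert hI using 1
      rw [hg]; ring_nf
    · obtain rfl := List.mem_singleton.1 hx
      have hg : ν (h + 1) = 1 := by simpa [ClockConstraint.Sat, Cmp.holds] using hg
      refine ⟨_, mem_toSet_singleton _, ?_⟩
      rw [← Int.cast_zero, value_int]
      simp only [EnvInv] at hI ⊢
      convert hI using 1
      rw [hg]; push_cast; ring_nf

/-- The environment prevents reachability if the first player wins the game robustly. -/
theorem EnvHyp.not_reachable (H : EnvHyp opts os q₀ J R₀ β z₀ η w b δ) (S : Set ℝ) :
    ¬ (system os q₀ J R₀ β z₀).Reachable S 7 δ := by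
  refine not_reachable_of_invariant (wellFormed_system ⟨w, H.rate_mem⟩)
    (fun c => ∃ l : Loc os.length, c.loc = l.num ∧
      EnvInv opts os J β z₀ η w b (Metric.ball 7 δ) l c.clock c.val) ?_ ?_ ?_
  · exact ⟨.init, rfl, rfl, rfl, rfl⟩
  · rintro c ⟨e, t⟩ ⟨l, hl, hI⟩ ⟨he, hsrc, hg, -⟩
    obtain ⟨l', x, hx, rfl⟩ := mem_edges.1 he
    obtain rfl : l' = l := Loc.num_injective (hsrc.trans hl)
    obtain ⟨r, hr, hI'⟩ := H.step hI hx hg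
    exact ⟨r, by rw [rateSet_num]; exact hr, _, rfl, hI'⟩
  · rintro c ⟨l, hl, hI⟩ ht
    have := List.mem_singleton.1 ht
    obtain rfl : l = .accept := Loc.num_injective (hl.symm.trans this)
    exact hI

end Soundness

end MultiModeGame

/-! ### Completeness: a win of the second player gives a scheduler strategy -/

namespace MultiModeGame

open StructuredBMS

section Completeness

variable {Q : Type} {os : List (Q × Opt Q)} {q₀ : Q} {J : ℕ} {R₀ : RateSet} {β z₀ : RatCode}
variable {A : Set ℝ} {p ε : ℝ}

theorem Forces.of_edge {l : Loc os.length} {ν : Fin 2 → ℝ} {z : ℝ} (t : ℝ)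
    {x : List ClockConstraint × List (Fin 2) × Loc os.length} (hx : x ∈ locEdges os q₀ l)
    (hg : ∀ g ∈ x.1, g.Sat ν) (ht : 0 ≤ t)
    (hA : ∀ r ∈ (locRate os J R₀ β x.2.2).toSet, z + t * r ∈ A)
    (h : ∀ r ∈ (locRate os J R₀ β x.2.2).toSet, Forces (system os q₀ J R₀ β z₀) A p ε
      ⟨x.2.2.num, moveClock ν x.2.1 t, z + t * r⟩) :
    Forces (system os q₀ J R₀ β z₀) A p ε ⟨l.num, ν, z⟩ := by
  refine .move ⟨⟨l.num, x.1, x.2.1, x.2.2.num⟩, t⟩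
    ⟨mem_edges.2 ⟨l, x, hx, rfl⟩, rfl, hg, ht⟩ ?_ ?_
  · intro r hr
    exact hA r (by rwa [rateSet_num] at hr)
  · intro r hr
    exact h r (by rwa [rateSet_num] at hr)

theorem Forces.of_edge_singleton {l : Loc os.length} {ν : Fin 2 → ℝ} {z : ℝ} (t : ℝ)
    {x : List ClockConstraint × List (Fin 2) × Loc os.length} (hx : x ∈ locEdges os q₀ l)
    (hg : ∀ g ∈ x.1, g.Sat ν) (ht : 0 ≤ t) {r : RatCode}
    (hr : locRate os J R₀ β x.2.2 = .finite [r]) (hA : z + t * r.value ∈ A)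
    (h : Forces (system os q₀ J R₀ β z₀) A p ε
      ⟨x.2.2.num, moveClock ν x.2.1 t, z + t * r.value⟩) :
    Forces (system os q₀ J R₀ β z₀) A p ε ⟨l.num, ν, z⟩ := by
  have : ∀ s ∈ (locRate os J R₀ β x.2.2).toSet, s = r.value := by
    rw [hr]
    rintro s ⟨q, hq, rfl⟩
    rw [List.mem_singleton.1 hq]
  exact .of_edge t hx hg ht (fun s hs => this s hs ▸ hA) fun s hs => this s hs ▸ h

variable {opts : Q → List (Opt Q)} {T : Set Q} {η b δ : ℝ}

/-- The assumptions under which the scheduler succeeds when the undisturbed value of the variable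
is `b`. -/
structure SchedHyp (opts : Q → List (Opt Q)) (os : List (Q × Opt Q)) (T : Set Q) (J : ℕ)
    (β : RatCode) (η b δ : ℝ) : Prop where
  mem : ∀ q ∈ T, ∀ o ∈ opts q, (q, o) ∈ os
  next_mem : ∀ q ∈ T, ∀ o ∈ opts q, ∀ a, ∀ q' ∈ o.next a, q' ∈ T
  mult_le : ∀ x ∈ os, |(x.2.mult : ℝ)| + 10 ≤ J
  input_nonneg : 0 ≤ β.value
  input_le : β.value ≤ 1
  abs_base_le : |b - 7| ≤ 1
  sub_mem_ball : ∀ g, |g| < η → b - g ∈ Metric.ball 7 δ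

theorem add_mem_Icc {L M B x y : ℝ} (hx : x ∈ Set.Icc (-M) M) (hy : |y| ≤ B) (h : M + B ≤ L) :
    x + y ∈ Set.Icc (-L) L := by
  rw [abs_le] at hy
  constructor <;> linarith [hx.1, hx.2]

theorem Icc_neg_subset {M L : ℝ} (h : M ≤ L) : Set.Icc (-M) M ⊆ Set.Icc (-L) L :=
  Set.Icc_subset_Icc (by linarith) h

/-- The scheduler succeeds after an unjustified objection. -/
theorem SchedHyp.forces_check (H : SchedHyp opts os T J β η b δ) {i : Fin os.length}
    {h a : Fin 2} {u u' : ℝ} (h0 : 0 ≤ u) (h1 : u ≤ 1) (ha : os[i].2.Allowed u')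
    (hu : |u' - os[i].2.image β.value u| < η) {ν : Fin 2 → ℝ} {z : ℝ} (hν : ν (h + 1) = 1 + u')
    (hν' : ν h = 1 + u + (1 + u')) (hz : z = b + (1 + u') * ((a.val + 2) * J)) :
    Forces (system os q₀ J R₀ β z₀) (Set.Icc (-(100 * J)) (100 * J)) 7 δ
      ⟨(Loc.guess i h).num, ν, z⟩ := by
  have hm := H.mult_le os[i] (List.getElem_mem _)
  have hb := abs_le.1 H.abs_base_le
  have hJ : (10 : ℝ) ≤ J := by have := abs_nonneg (os[i].2.mult : ℝ); linarith
  have ha0 := ha.1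
  have ha1 := ha.2.1
  have hs : |(objSign a : ℝ)| = 1 := abs_objSign a
  have hav : |(a.val + 2 : ℝ) * J| ≤ 3 * J := by
    have : (a.val : ℝ) ≤ 1 := by exact_mod_cast (show a.val ≤ 1 by omega)
    rw [abs_of_nonneg (by positivity)]
    exact mul_le_mul_of_nonneg_right (by linarith) (by linarith)
  have hsm : |(objSign a : ℝ) * os[i].2.mult| ≤ J := by rw [abs_mul, hs]; linarith
  have hmul : ∀ {t r B : ℝ}, 0 ≤ t → t ≤ 3 → |r| ≤ B → |t * r| ≤ 3 * B := by
    intro t r B ht ht' hr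
    rw [abs_mul, abs_of_nonneg ht]
    exact mul_le_mul ht' hr (abs_nonneg _) (by norm_num)
  have hr0 : |(checkRate J os[i].2 a 0 : ℝ)| ≤ 3 * J + 1 := by
    simp only [checkRate]; push_cast
    exact (abs_add_le _ _).trans (by rw [hs]; linarith)
  have hr1 : |(checkRate J os[i].2 a 1 : ℝ)| ≤ 4 * J + 1 := by
    simp only [checkRate] at hr0 ⊢; push_cast at hr0 ⊢
    exact (abs_add_le _ _).trans (by linarith)
  have hr2 : |(checkRate J os[i].2 a 2 : ℝ)| ≤ 16 * J + 6 := by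
    simp only [checkRate] at hr0 ⊢; push_cast at hr0 ⊢
    have hs' := abs_le.1 hs.le
    rw [abs_le] at hr0 hsm ⊢
    constructor <;> linarith [hr0.1, hr0.2, hsm.1, hsm.2, hs'.1, hs'.2]
  have hr3 : |(inputRate β os[i].2 a).value| ≤ 1 := by
    rw [value_inputRate, abs_mul, hs, one_mul]
    split
    · rw [abs_of_nonneg H.input_nonneg]; exact H.input_le
    · simp
  have z0 : z ∈ Set.Icc (-(8 + 9 * J : ℝ)) (8 + 9 * J) := by
    rw [hz]
    refine add_mem_Icc (M := 8) ⟨by linarith, by linarith⟩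
      (hmul (by linarith) (by linarith) hav) (by linarith)
  -- The four stages last `3 - u - u'`, `1 + u`, `1` and `1`, each at most `3`, so the bound grows
  -- by three times the rate bound. The final bound is below `100 * J` because `J ≥ 10`.
  have z1 := add_mem_Icc (L := 18 * J + 11) z0
    (hmul (t := 3 - u - u') (by linarith) (by linarith) hr0) (by linarith)
  have z2 := add_mem_Icc (L := 30 * J + 14) z1
    (hmul (t := 1 + u) (by linarith) (by linarith) hr1) (by linarith)
  have z3 := add_mem_Icc (L := 78 * J + 32) z2
    (hmul (t := 1) (by linarith) (by linarith) hr2) (by linarith)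
  have z4 := add_mem_Icc (L := 78 * J + 35) z3
    (hmul (t := 1) (by linarith) (by linarith) hr3) (by linarith)
  have hfin : z + (3 - u - u') * (checkRate J os[i].2 a 0 : ℝ) +
      (1 + u) * (checkRate J os[i].2 a 1 : ℝ) + 1 * (checkRate J os[i].2 a 2 : ℝ) +
      1 * (inputRate β os[i].2 a).value ∈ Metric.ball 7 δ := by
    have e := check_value (J := J) (β := β) os[i].2 a (a.val + 2) (1 + u) (1 + u') b
    have := H.sub_mem_ball (objSign a * (u' - os[i].2.image β.value u)) (by
      rwa [abs_mul, hs, one_mul])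
    convert this using 1
    simp only [add_sub_cancel_left, sub_self, zero_mul, add_zero] at e
    rw [← e, hz]
    ring
  have hne := fin2_succ_ne h
  refine .of_edge_singleton (x := (_, _, .check 0 i h a)) (3 - u - u')
    (List.mem_append_right _ (List.mem_map.2 ⟨a, List.mem_finRange _, rfl⟩))
    (sat_guessGuard.2 (by rw [hν]; simpa using ha)) (by linarith) rfl
    (by rw [value_ratCode]; exact Icc_neg_subset (by linarith) z1) ?_
  refine .of_edge_singleton (x := (_, _, .check 1 i h a)) (1 + u)
    (List.mem_singleton_self _) ?_ (by linarith) rfl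
    (by simp only [value_ratCode]; exact Icc_neg_subset (by linarith) z2) ?_
  · simp [ClockConstraint.Sat, Cmp.holds, moveClock, hν']; ring_nf
  refine .of_edge_singleton (x := (_, _, .check 2 i h a)) 1
    (List.mem_singleton_self _) ?_ (by linarith) rfl
    (by simp only [value_ratCode]; exact Icc_neg_subset (by linarith) z3) ?_
  · simp [ClockConstraint.Sat, Cmp.holds, moveClock, hν]; ring_nf
  refine .of_edge_singleton (x := (_, _, .check 3 i h a)) 1
    (List.mem_singleton_self _) ?_ (by linarith) rfl
    (by simp only [value_ratCode]; exact Icc_neg_subset (by linarith) z4) ?_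
  · simp [ClockConstraint.Sat, Cmp.holds, moveClock]
  refine .of_edge_singleton (x := (_, _, .accept)) 0
    (List.mem_singleton_self _) ?_ le_rfl rfl
    (by simp only [value_ratCode, zero_mul, add_zero]; exact Icc_neg_subset (by linarith) z4) ?_
  · simp [ClockConstraint.Sat, Cmp.holds, moveClock]
  refine .target (List.mem_singleton_self _) ?_
  simp only [value_ratCode, zero_mul, add_zero]
  exact hfin

/-- The scheduler forces the target if the second player wins the game with tolerance. -/
theorem SchedHyp.forces (H : SchedHyp opts os T J β η b δ) {n : Option Q} {u : ℝ}
    (hw : SecondWin opts β.value η n u) :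
    ∀ q ∈ n, q ∈ T → 0 ≤ u → u ≤ 1 → ∀ (h : Fin 2) (l : Loc os.length) (ν : Fin 2 → ℝ)
      (g : List ClockConstraint) (reset : List (Fin 2)),
      (∀ i ∈ optsAt os q, (g, reset, .guess i h) ∈ locEdges os q₀ l) → (∀ c ∈ g, c.Sat ν) →
      h ∉ reset → h + 1 ∈ reset → ν h = 1 + u →
      Forces (system os q₀ J R₀ β z₀) (Set.Icc (-(100 * J)) (100 * J)) 7 δ ⟨l.num, ν, b⟩ := by
  induction hw with
  | accept => simp
  | @step q u o u' ho ha hu hnext ih =>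
    intro q' hq' hT h0 h1 h l ν g reset hedge hg hr1 hr2 hν
    obtain rfl : q = q' := by simpa using hq'
    obtain ⟨i, hi⟩ : ∃ i : Fin os.length, os[i] = (q, o) :=
      let ⟨n, hn, hi⟩ := List.getElem_of_mem (H.mem q hT o ho)
      ⟨⟨n, hn⟩, hi⟩
    have hi2 : os[i].2 = o := by rw [hi]
    have hb := abs_le.1 H.abs_base_le
    have ha0 := ha.1
    have ha1 := ha.2.1
    have hJ : (10 : ℝ) ≤ J := by
      have := H.mult_le os[i] (List.getElem_mem _)
      have := abs_nonneg (os[i].2.mult : ℝ)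
      linarith
    have hne := fin2_succ_ne h
    have hbA : b ∈ Set.Icc (-(100 * J : ℝ)) (100 * J) := ⟨by linarith, by linarith⟩
    have hbound : ∀ (k : ℕ), k ≤ 3 → b + (1 + u') * (k * J) ∈ Set.Icc (-(100 * J : ℝ)) (100 * J) := by
      intro k hk
      have hk' : (k : ℝ) ≤ 3 := by exact_mod_cast hk
      have h2 : (k * J : ℝ) ≤ 3 * J := mul_le_mul_of_nonneg_right hk' (by linarith)
      have h3 : (0 : ℝ) ≤ k * J := by positivity
      constructor <;> nlinarith
    have hrate : ∀ r ∈ (locRate os J R₀ β (.guess i h)).toSet,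
        (∃ a : Fin 2, r = a.val * J) ∨ ∃ a : Fin 2, r = (a.val + 2) * J := by
      rintro r ⟨c, hc, rfl⟩
      simp only [List.mem_cons, List.not_mem_nil, or_false] at hc
      rcases hc with rfl | rfl | rfl | rfl
      · exact .inl ⟨0, by simp [RatCode.value]⟩
      · exact .inl ⟨1, by simp [RatCode.value]⟩
      · exact .inr ⟨0, by simp [RatCode.value]⟩
      · exact .inr ⟨1, by simp [RatCode.value]; norm_num⟩
    refine .of_edge (1 + u') (hedge i (mem_optsAt.2 (by rw [hi]))) hg (by linarith) ?_ ?_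
    · intro r hr
      rcases hrate r hr with ⟨a, rfl⟩ | ⟨a, rfl⟩
      · exact hbound a.val (by omega)
      · exact_mod_cast hbound (a.val + 2) (by omega)
    intro r hr
    have c1 : moveClock ν reset (1 + u') (h + 1) = 1 + u' := by simp [moveClock, hr2]
    have c2 : moveClock ν reset (1 + u') h = 1 + u + (1 + u') := by simp [moveClock, hr1, hν]
    rcases hrate r hr with ⟨a, rfl⟩ | ⟨a, rfl⟩
    swap
    · exact H.forces_check h0 h1 (by rwa [hi2]) (by rwa [hi2]) c1 c2 rfl
    generalize moveClock ν reset (1 + u') = ν' at c1 c2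
    refine .of_edge_singleton (x := (_, _, .hold i h a)) (2 - u')
      (List.mem_append_left _ (List.mem_map.2 ⟨a, List.mem_finRange _, rfl⟩))
      (sat_guessGuard.2 (by rw [c1, hi2]; simpa using ha)) (by linarith) rfl ?_ ?_
    · rw [value_int, Int.cast_zero, mul_zero, add_zero]
      exact hbound a.val (by omega)
    -- After a true declaration `undo` cancels the announcement exactly, and the next round starts
    -- again from `b`.
    have e1 : b + (1 + u') * (a.val * J) + (2 - u') * RatCode.value (0, 0) +
        (1 + u') * RatCode.value (-(a.val * J : ℕ), 0) = b := by
      rw [value_int, value_int]; push_cast; ring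
    refine .of_edge_singleton (x := (_, _, .undo i h a)) (1 + u')
      (List.mem_singleton_self _) ?_ (by linarith) rfl (by rw [e1]; exact hbA) ?_
    · simp [ClockConstraint.Sat, Cmp.holds, moveClock, hne, c1]; ring_nf
    simp only [e1]
    have d1 : moveClock (moveClock ν' [h] (2 - u')) [h + 1] (1 + u') h = 3 := by
      simp [moveClock, hne.symm]; ring_nf
    have d2 : moveClock (moveClock ν' [h] (2 - u')) [h + 1] (1 + u') (h + 1) = 1 + u' := by
      simp [moveClock]
    generalize moveClock (moveClock ν' [h] (2 - u')) [h + 1] (1 + u') = ν'' at d1 d2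
    cases hq : o.next a with
    | none =>
      have hη : 0 < η := (abs_nonneg _).trans_lt hu
      have e2 : b + 0 * RatCode.value (0, 0) = b := by ring
      refine .of_edge_singleton (x := ([⟨h, .eq, 3⟩], [h], .accept)) 0 ?_
        ?_ le_rfl rfl (by rw [e2]; exact hbA) (.target (List.mem_singleton_self _) ?_)
      · simp only [locEdges, hi2, hq]
        exact List.mem_singleton_self _
      · simpa [ClockConstraint.Sat, Cmp.holds] using d1
      · rw [e2]
        simpa using H.sub_mem_ball 0 (by simpa using hη)
    | some q' =>
      refine ih a q' hq (H.next_mem q hT o ho a q' hq) ha0 ha1 (h + 1) _ _ [⟨h, .eq, 3⟩] [h]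
        ?_ ?_ (by simp [hne]) (by simp [fin2_succ_succ]) d2
      · intro j hj
        simp only [locEdges, hi2, hq]
        exact List.mem_map.2 ⟨j, hj, rfl⟩
      · simpa [ClockConstraint.Sat, Cmp.holds] using d1

/-- The scheduler achieves its goal if the second player wins for every initial rate. -/
theorem reachable_of_secondWin {S : Set ℝ} (hS : Set.Icc (-(100 * J : ℝ)) (100 * J) ⊆ S)
    (hq₀ : q₀ ∈ T) (hJ : 10 ≤ J) (hz₀ : |z₀.value - 7| ≤ 1)
    (h : ∀ w ∈ R₀.toSet, ∃ η, SchedHyp opts os T J β η (z₀.value + w) δ ∧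
      SecondWin opts β.value η (some q₀) 0) :
    (system os q₀ J R₀ β z₀).Reachable S 7 δ := by
  have hJ' : (10 : ℝ) ≤ J := by exact_mod_cast hJ
  have hz := abs_le.1 hz₀
  have hmem : z₀.value ∈ Set.Icc (-(100 * J : ℝ)) (100 * J) := ⟨by linarith, by linarith⟩
  refine Forces.reachable (convex_Icc _ _) hS ?_ hmem
  refine .of_edge (l := .init) (x := (_, _, .wait)) 1 (List.mem_singleton_self _) (by simp)
    zero_le_one ?_ ?_
  · intro w hw
    obtain ⟨η, H, -⟩ := h w hw
    have hb := abs_le.1 H.abs_base_le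
    rw [one_mul]
    change z₀.value + w ∈ _
    exact ⟨by linarith, by linarith⟩
  · intro w hw
    obtain ⟨η, H, hwin⟩ := h w hw
    rw [one_mul]
    refine H.forces hwin q₀ rfl hq₀ le_rfl zero_le_one 1 .wait _ [⟨0, .eq, 1⟩] [0] ?_ ?_
      (by simp) (by simp) (by simp [moveClock])
    · exact fun i hi => List.mem_map.2 ⟨i, hi, rfl⟩
    · simp [ClockConstraint.Sat, Cmp.holds, moveClock]

end Completeness

end MultiModeGame

namespace MultiModeGame

open StructuredBMS
open Function (update)

/-! ### Undecidability -/

theorem Instr.finite_uses {Λ : Type} (I : Instr Λ) : {i | I.Uses i}.Finite := by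
  cases I <;> simp [Instr.Uses]

theorem simOpts_next_mem {Λ : Type} {ins : Λ → Instr Λ} {R : ℕ} {T : Set Λ} {start : Λ}
    (hT : IsControlSet ins R T) (hs : start ∈ T) {T' : Set (SimState Λ)}
    (hT' : T' = {.init} ∪ SimState.prog '' T ∪ SimState.strip '' ({none} ∪ some '' Set.Iio R)) :
    ∀ q ∈ T', ∀ o ∈ simOpts R start ins q, ∀ a, ∀ q' ∈ o.next a, q' ∈ T' := by
  have hprog : ∀ l ∈ T, SimState.prog l ∈ T' := fun l hl => by simp [hT', hl]
  have hstrip : SimState.strip none ∈ T' := by simp [hT']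
  have hstrip' : ∀ i < R, SimState.strip (some i) ∈ T' := fun i hi => by simp [hT', hi]
  intro q hq o ho a q' hq'
  cases q with
  | init =>
    obtain rfl := List.mem_singleton.1 ho
    obtain rfl := Option.some.inj hq'
    exact hprog _ hs
  | strip ex =>
    rcases List.mem_cons.1 ho with rfl | ho
    · cases hq'
    · obtain ⟨p, -, rfl⟩ := List.mem_map.1 ho
      obtain rfl := Option.some.inj hq'
      exact hq
  | prog l =>
    have hl : l ∈ T := by simpa [hT'] using hq
    have hsucc := hT.succs_mem l hl
    have hlt := hT.lt l hl
    rcases List.mem_cons.1 ho with rfl | ho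
    · cases hq'
    · cases hins : ins l with
      | win => simp [hins, instrOpts] at ho
      | lose =>
        rw [hins] at ho
        obtain rfl := List.mem_singleton.1 ho
        cases hq'
      | incr i b =>
        rw [hins] at ho hsucc
        obtain rfl := List.mem_singleton.1 ho
        obtain rfl := Option.some.inj hq'
        exact hprog _ (hsucc _ (by simp [Instr.succs]))
      | decz i b c =>
        rw [hins] at ho hsucc hlt
        have hi := hstrip' i (hlt i rfl)
        have hb := hprog b (hsucc b (by simp [Instr.succs]))
        have hc := hprog c (hsucc c (by simp [Instr.succs]))
        simp only [instrOpts, List.mem_cons, List.not_mem_nil, or_false] at ho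
        rcases ho with rfl | rfl <;> fin_cases a <;> obtain rfl := Option.some.inj hq' <;>
          assumption
      | eor b c =>
        rw [hins] at ho hsucc
        have hb := hprog b (hsucc b (by simp [Instr.succs]))
        have hc := hprog c (hsucc c (by simp [Instr.succs]))
        obtain rfl := List.mem_singleton.1 ho
        fin_cases a <;> obtain rfl := Option.some.inj hq' <;> assumption
      | sand b c =>
        rw [hins] at ho hsucc
        have hb := hprog b (hsucc b (by simp [Instr.succs]))
        have hc := hprog c (hsucc c (by simp [Instr.succs]))
        simp only [instrOpts, List.mem_cons, List.not_mem_nil, or_false] at ho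
        rcases ho with rfl | rfl <;> obtain rfl := Option.some.inj hq' <;> assumption

/-- The number that represents the input `n`. -/
noncomputable def inputCode (n : ℕ) : RatCode := (1, oddPrime 0 ^ n - 1)

theorem value_inputCode (n : ℕ) : (inputCode n).value = 1 / (oddPrime 0 ^ n : ℕ) := by
  have h : ((oddPrime 0 ^ n - 1 : ℕ) : ℝ) + 1 = (oddPrime 0 ^ n : ℕ) := by
    exact_mod_cast Nat.sub_add_cancel (Nat.one_le_pow _ _ (prime_oddPrime 0).pos)
  rw [RatCode.value, inputCode, h]
  simp

theorem inputCode_nonneg (n : ℕ) : 0 ≤ (inputCode n).value := by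
  rw [value_inputCode]
  positivity

theorem inputCode_le_one (n : ℕ) : (inputCode n).value ≤ 1 := by
  have : (1 : ℝ) ≤ (oddPrime 0 ^ n : ℕ) := by
    exact_mod_cast Nat.one_le_pow _ _ (prime_oddPrime 0).pos
  rw [value_inputCode, div_le_one (by linarith)]
  exact this

/-- A finite game whose winner tells whether a partial recursive function is defined. -/
theorem exists_game {f : ℕ →. ℕ} (hf : Partrec f) :
    ∃ (Q : Type) (opts : Q → List (Opt Q)) (q₀ : Q) (os : List (Q × Opt Q)) (T : Set Q) (J : ℕ),
      q₀ ∈ T ∧ 10 ≤ J ∧ (∀ x ∈ os, x.2 ∈ opts x.1) ∧ (∀ q ∈ T, ∀ o ∈ opts q, (q, o) ∈ os) ∧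
      (∀ q ∈ T, ∀ o ∈ opts q, ∀ a, ∀ q' ∈ o.next a, q' ∈ T) ∧
      (∀ x ∈ os, |(x.2.mult : ℝ)| + 10 ≤ J) ∧
      (∀ n, (f n).Dom → ExactWin opts (inputCode n).value q₀ 0) ∧
      ∀ n, ¬ (f n).Dom → ∀ η, 0 < η → SecondWin opts (inputCode n).value η (some q₀) 0 := by
  obtain ⟨P, hP⟩ := exists_prog_of_partrec hf
  obtain ⟨T, hfin, hPT, hclosed⟩ := P.exists_finite_closed
  obtain ⟨R, hR0, hR⟩ : ∃ R, 0 < R ∧ ∀ l ∈ T, ∀ i, l.instr.Uses i → i < R := by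
    obtain ⟨B, hB⟩ := (hfin.biUnion fun l _ => l.instr.finite_uses).bddAbove
    exact ⟨B + 1, B.succ_pos, fun l hl i hi =>
      Nat.lt_succ_of_le (hB (Set.mem_biUnion hl hi))⟩
  have hT : IsControlSet Prog.instr R T := ⟨hclosed, hR⟩
  obtain ⟨T', hT'⟩ : ∃ T' : Set (SimState Prog), T' = {.init} ∪ SimState.prog '' T ∪
      SimState.strip '' ({none} ∪ some '' Set.Iio R) := ⟨_, rfl⟩
  have hfin' : T'.Finite := by
    rw [hT']
    exact ((Set.finite_singleton _).union (hfin.image _)).union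
      (((Set.finite_singleton _).union ((Set.finite_Iio R).image _)).image _)
  -- Restricting to the finite closed set `T'` makes the list of options finite, and hence a common
  -- bound `J` exists. None of this depends on the input.
  set os := hfin'.toFinset.toList.flatMap fun q => (simOpts R P Prog.instr q).map (Prod.mk q) with hos
  have hmem : ∀ x, x ∈ os ↔ x.1 ∈ T' ∧ x.2 ∈ simOpts R P Prog.instr x.1 := by
    rintro ⟨q, o⟩
    simp only [hos, List.mem_flatMap, Finset.mem_toList, Set.Finite.mem_toFinset, List.mem_map,
      Prod.mk.injEq]
    constructor
    · rintro ⟨q, hq, o, ho, rfl, rfl⟩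
      exact ⟨hq, ho⟩
    · rintro ⟨hq, ho⟩
      exact ⟨q, hq, o, ho, rfl, rfl⟩
  obtain ⟨B, hB⟩ := (os.finite_toSet.image fun x => |(x.2.mult : ℝ)| + 10).bddAbove
  obtain ⟨J, hJ⟩ := exists_nat_ge (max B 10)
  refine ⟨_, simOpts R P Prog.instr, .init, os, T', J, by simp [hT'],
    by exact_mod_cast (le_max_right _ _).trans hJ, fun x hx => ((hmem x).1 hx).2,
    fun q hq o ho => (hmem (q, o)).2 ⟨hq, ho⟩, simOpts_next_mem hT hPT hT',
    fun x hx => (hB ⟨x, hx, rfl⟩).trans ((le_max_left _ _).trans hJ), ?_, ?_⟩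
  · intro n hn
    rw [value_inputCode]
    exact exactWin_init hT hR0 hPT ((hP n).2 hn)
  · intro n hn η hη
    rw [value_inputCode]
    exact secondWin_init hT hR0 hPT (fun h => hn ((hP n).1 h)) hη

theorem primrec_pow (p : ℕ) : Primrec fun n : ℕ => p ^ n := by
  refine (Primrec.nat_rec₁ 1 (f := fun _ m => m * p)
    (Primrec.nat_mul.comp Primrec.snd (Primrec.const p)).to₂).of_eq fun n => ?_
  induction n with
  | zero => rfl
  | succ n ih => rw [pow_succ, ← ih]

theorem primrec_rateSet_singleton {α : Type} [Primcodable α] {x : α → RatCode} (hx : Primrec x) :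
    Primrec fun a => RateSet.finite [x a] :=
  (Primrec.of_equiv_symm (e := RateSet.equiv)).comp
    ((Primrec.sumInl (α := List RatCode) (β := (RatCode × RatCode) ⊕ (RatCode × RatCode))).comp
      (Primrec.list_cons.comp hx (Primrec.const [])))

/-- Only the rate of the last checking stage varies with the input; all other data are constants, so
it does not matter how they were obtained. -/
theorem primrec_system {Q : Type} (os : List (Q × Opt Q)) (q₀ : Q) (J : ℕ) (R₀ : RateSet)
    (z₀ : RatCode) : Primrec fun n => system os q₀ J R₀ (inputCode n) z₀ := by
  have hpow : Primrec fun n : ℕ => oddPrime 0 ^ n - 1 :=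
    Primrec.nat_sub.comp (primrec_pow _) (Primrec.const 1)
  have hloc : ∀ l : Loc os.length, Primrec fun n => locRate os J R₀ (inputCode n) l := by
    intro l
    cases l with
    | check s i h a =>
      obtain rfl | rfl | rfl | rfl : s = 0 ∨ s = 1 ∨ s = 2 ∨ s = 3 := by fin_cases s <;> simp
      · exact Primrec.const _
      · exact Primrec.const _
      · exact Primrec.const _
      · refine primrec_rateSet_singleton ?_
        unfold inputRate
        split
        · exact Primrec.pair (Primrec.const (objSign a * 1)) hpow
        · exact Primrec.const _
    | _ => exact Primrec.const _
  exact (Primrec.of_equiv_symm (e := StructuredBMS.equiv)).comp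
    ((Primrec.list_ofFn fun k => hloc _).pair (Primrec.const (allEdges os q₀, _, z₀, _)))

theorem not_computablePred_of_forall {p : StructuredBMS → Prop} {g : ℕ → StructuredBMS}
    (hg : Primrec g)
    (h : ∀ c : Nat.Partrec.Code, p (g (Encodable.encode c)) ↔ ¬ (c.eval 0).Dom) :
    ¬ ComputablePred p := fun hp => by
  refine ComputablePred.halting_problem 0 ?_
  refine ComputablePred.computable_of_manyOneReducible
    ⟨fun c => g (Encodable.encode c), (hg.comp Primrec.encode).to_comp, fun c => ?_⟩ hp.not
  rw [h, not_not]

theorem partrec_halting :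
    Partrec fun k : ℕ => (Denumerable.ofNat Nat.Partrec.Code k).eval 0 :=
  Nat.Partrec.Code.eval_part.comp (Computable.ofNat _) (Computable.const 0)

theorem isInstance_system {Q : Type} {os : List (Q × Opt Q)} {q₀ : Q} {J : ℕ} {R₀ : RateSet}
    {β z₀ : RatCode} {S : Set ℝ} {L : ℝ} (hR : R₀.toSet.Nonempty) (hL : Set.Icc (-L) L ⊆ S)
    (hz : |z₀.value| < L) : (system os q₀ J R₀ β z₀).IsInstance S := by
  refine ⟨wellFormed_system hR, interior_mono hL ?_⟩
  rw [interior_Icc]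
  exact abs_lt.1 hz

theorem value_seven : RatCode.value (7, 0) = 7 := by norm_num [RatCode.value]

/-- The initial rate is `0` and the base value `7`, so the radius `ε` is itself the tolerance of the
game. -/
theorem exists_not_computablePred_robustlyReachable :
    ∃ L : ℝ, 7 < L ∧ ∀ S : Set ℝ, Set.Icc (-L) L ⊆ S →
      ¬ ComputablePred fun H : StructuredBMS => H.IsInstance S ∧ H.RobustlyReachable S 7 := by
  obtain ⟨Q, opts, q₀, os, T, J, hq₀, hJ, hos, hmem, hnext, hmult, hexact, hsecond⟩ :=
    exists_game partrec_halting
  have hJ' : (10 : ℝ) ≤ J := by exact_mod_cast hJ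
  refine ⟨100 * J, by linarith, fun S hS => ?_⟩
  refine not_computablePred_of_forall
    (primrec_system os q₀ J (.finite [(0, 0)]) (7, 0)) fun c => ?_
  have hR : (0 : ℝ) ∈ (RateSet.finite [(0, 0)]).toSet := ⟨_, List.mem_singleton_self _, by
    simp [RatCode.value]⟩
  have hdist : ∀ g r : ℝ, (7 : ℝ) - g ∈ Metric.ball 7 r ↔ |g| < r := fun g r => by
    rw [Metric.mem_ball, Real.dist_eq, sub_sub_cancel_left, abs_neg]
  constructor
  · rintro ⟨-, hreach⟩ hdom
    obtain ⟨η, hη, hwin⟩ := (hexact (Encodable.encode c) (by simpa using hdom)).exists_robustWin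
    refine EnvHyp.not_reachable (opts := opts) (η := η) (w := 0) (b := 7) (δ := min η 1)
      ⟨hos, hmult, inputCode_nonneg _, inputCode_le_one _, hR, by rw [value_seven, add_zero],
        by simp, min_le_right _ _, fun g hg => ?_, hwin⟩ S
      (hreach _ (lt_min hη one_pos))
    rw [hdist] at hg
    exact (le_abs_self g).trans_lt (hg.trans_le (min_le_left _ _))
  · intro hdom
    refine ⟨isInstance_system ⟨0, hR⟩ hS (by rw [value_seven, abs_of_pos] <;> linarith),
      fun ε hε => ?_⟩
    refine reachable_of_secondWin hS hq₀ hJ (by simp [value_seven]) fun w hw => ⟨ε, ?_,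
      hsecond _ (by simpa using hdom) ε hε⟩
    obtain ⟨q, hq, rfl⟩ := hw
    have e : RatCode.value (7, 0) + q.value = 7 := by
      rw [List.mem_singleton.1 hq, value_seven]; simp [RatCode.value]
    rw [e]
    exact ⟨hmem, hnext, hmult, inputCode_nonneg _, inputCode_le_one _, by simp,
      fun g hg => (hdist g ε).2 hg⟩

/-- With base value `7 - Δ + w` the near end of the target ball is at distance `w`. The environment
draws `w` from an open interval, so it can select any small positive tolerance but not zero. -/
theorem exists_not_computablePred_reachable {Δ : ℚ} (h0 : 0 < Δ) (h1 : Δ < 1) :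
    ∃ L : ℝ, 7 < L ∧ ∀ S : Set ℝ, Set.Icc (-L) L ⊆ S →
      ¬ ComputablePred fun H : StructuredBMS => H.IsInstance S ∧ H.Reachable S 7 (Δ : ℝ) := by
  obtain ⟨Q, opts, q₀, os, T, J, hq₀, hJ, hos, hmem, hnext, hmult, hexact, hsecond⟩ :=
    exists_game partrec_halting
  have hJ' : (10 : ℝ) ≤ J := by exact_mod_cast hJ
  refine ⟨100 * J, by linarith, fun S hS => ?_⟩
  have h0' : (0 : ℝ) < Δ := by exact_mod_cast h0
  have h1' : (Δ : ℝ) < 1 := by exact_mod_cast h1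
  have hz : (ratCode (7 - Δ)).value = 7 - Δ := by rw [value_ratCode]; push_cast; rfl
  have hR : (RateSet.openInterval (0, 0) (ratCode Δ)).toSet = Set.Ioo 0 (Δ : ℝ) := by
    simp only [RateSet.toSet, value_ratCode, value_int, Int.cast_zero]
  refine not_computablePred_of_forall
    (primrec_system os q₀ J (.openInterval (0, 0) (ratCode Δ)) (ratCode (7 - Δ))) fun c => ?_
  constructor
  · rintro ⟨-, hreach⟩ hdom
    obtain ⟨η, hη, hwin⟩ := (hexact (Encodable.encode c) (by simpa using hdom)).exists_robustWin
    have hw0 : 0 < min η Δ := lt_min hη h0'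
    have hw1 : min η Δ ≤ Δ := min_le_right _ _
    have hw2 : min η Δ ≤ η := min_le_left _ _
    -- Halving keeps the rate strictly inside the open interval; signed errors that still reach the
    -- ball are below `w`, hence below `η`.
    refine EnvHyp.not_reachable (opts := opts) (η := η) (w := min η Δ / 2)
      (b := 7 - Δ + min η Δ / 2) (δ := Δ)
      ⟨hos, hmult, inputCode_nonneg _, inputCode_le_one _, ?_, by rw [hz],
        ?_, h1'.le, fun g hg => ?_, hwin⟩ S hreach
    · rw [hR]
      constructor <;> linarith
    · rw [abs_le]
      constructor <;> linarith
    · rw [Metric.mem_ball, Real.dist_eq, abs_lt] at hg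
      linarith [hg.1]
  · intro hdom
    refine ⟨isInstance_system ?_ hS ?_, ?_⟩
    · rw [hR]
      exact Set.nonempty_Ioo.2 h0'
    · rw [hz, abs_lt]
      constructor <;> linarith
    refine reachable_of_secondWin (opts := opts) hS hq₀ hJ ?_ fun w hw => ?_
    · rw [hz, abs_le]
      constructor <;> linarith
    · rw [hR] at hw
      -- The scheduler has seen `w` and uses it as tolerance. Errors below `w` in absolute value
      -- leave the variable between `7 - Δ` and `7 - Δ + 2 * w`, and `w < Δ`.
      refine ⟨w, ⟨hmem, hnext, hmult, inputCode_nonneg _, inputCode_le_one _, ?_, fun g hg => ?_⟩,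
        hsecond _ (by simpa using hdom) w hw.1⟩
      · rw [hz, abs_le]
        constructor <;> linarith [hw.1, hw.2]
      · rw [hz, Metric.mem_ball, Real.dist_eq, abs_lt]
        rw [abs_lt] at hg
        constructor <;> linarith [hw.1, hw.2, hg.1, hg.2]

end MultiModeGame

theorem mainTheorem3 :
    (∃ L : ℝ, 7 < L ∧ ∀ S : Set ℝ, Convex ℝ S → Set.Icc (-L) L ⊆ S →
      ¬ ComputablePred fun H : StructuredBMS => H.IsInstance S ∧ H.RobustlyReachable S 7) ∧
    (∀ Δ : ℚ, 0 < Δ → Δ < 1 →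
      ∃ L : ℝ, 7 < L ∧ ∀ S : Set ℝ, Convex ℝ S → Set.Icc (-L) L ⊆ S →
        ¬ ComputablePred fun H : StructuredBMS => H.IsInstance S ∧ H.Reachable S 7 (Δ : ℝ)) := by
  obtain ⟨L, hL, h⟩ := MultiModeGame.exists_not_computablePred_robustlyReachable
  refine ⟨⟨L, hL, fun S _ => h S⟩, fun Δ h0 h1 => ?_⟩
  obtain ⟨L, hL, h⟩ := MultiModeGame.exists_not_computablePred_reachable h0 h1
  exact ⟨L, hL, fun S _ => h S⟩
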